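/- Let $n\ge 1$. A convex body is a nonempty compact convex set $\Omega\subset\mathbb R^{n+1}$; $|\cdot|$ is Lebesgue measure, $B(1)$ the unit ball of $\mathbb R^{n+1}$, and $u_{z_0}(x)=\sup_{z\in\Omega}\langle z-z_0,x\rangle$. Let $d\theta$ be the surface measure on the unit sphere $\mathbb S^n$, of total mass $|\mathbb S^n|$. For $\alpha>0$ set $\mathcal E_\alpha(\Omega)=\sup_{z_0\in\Omega}\mathcal E_\alpha(\Omega,z_0)$, where $$\mathcal E_\alpha(\Omega,z_0)=\frac{\alpha}{\alpha-1}\log\Big(\frac1{|\mathbb S^n|}\int_{\mathbb S^n}u_{z_0}(x)^{1-\frac1\alpha}\,d\theta(x)\Big)\ (\alpha\ne1),\qquad \mathcal E_1(\Omega,z_0)=\frac1{|\mathbb S^n|}\int_{\mathbb S^n}\log u_{z_0}(x)\,d\theta(x),$$ with values in $[-\infty,\infty]$ (the value is $-\infty$ if $\alpha\le1$ and the integral diverges). Let $\rho_-(\Omega)$ be the radius of the biggest ball contained in $\Omega$, $\rho_+(\Omega)$ the radius of the smallest ball containing $\Omega$, and $w_-(\Omega)$, $w_+(\Omega)$ the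 minimum and maximum over $x\in\mathbb S^n$ of the width $w(x)=u_{z_0}(x)+u_{z_0}(-x)$ (which does not depend on $z_0$). (i) For each $\alpha>\frac1{n+2}$ there exist positive constants $\beta$ and $C$ depending only on $\alpha$ and $n$ such that for every convex body $\Omega$ with $|\Omega|=|B(1)|$, $\mathcal E_\alpha(\Omega)$ is finite, $$\min\{\rho_-(\Omega),w_-(\Omega)\}\ge C^{-1}e^{-\beta\mathcal E_\alpha(\Omega)}\quad\text{and}\quad \max\{w_+(\Omega),\rho_+(\Omega)\}\le C\,e^{n\beta\mathcal E_\alpha(\Omega)}.$$ (ii) For each $\alpha\in(0,\frac1{n+2})$ there exists a positive constant $C$ depending only on $\alpha$ and $n$ such that for every convex body $\Omega$ with $|\Omega|=|B(1)|$, $\mathcal E_\alpha(\Omega)$ is finite and $$\Big|\mathcal E_\alpha(\Omega)-\frac{1-\alpha(n+2)}{1-\alpha}\log\rho_-(\Omega)\Big|\le C.$$ -/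

import Mathlib

open MeasureTheory

noncomputable section

namespace ConvexEntropy

/-- The support function `u_{z₀}(x) = sup_{z ∈ Ω} ⟨z - z₀, x⟩` of `Ω` with respect to `z₀`. -/
def supportFn {d : ℕ} (Ω : ConvexBody (EuclideanSpace ℝ (Fin d)))
    (z₀ x : EuclideanSpace ℝ (Fin d)) : ℝ :=
  sSup ((fun z => inner ℝ (z - z₀) x) '' (Ω : Set (EuclideanSpace ℝ (Fin d))))

/-- The surface measure `dθ` on the unit sphere of `ℝ^d`. -/
def sphereMeasure (d : ℕ) :
    Measure (Metric.sphere (0 : EuclideanSpace ℝ (Fin d)) 1) :=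
  (volume : Measure (EuclideanSpace ℝ (Fin d))).toSphere

/-- The mean of an extended-real function on the unit sphere: the mean of the positive part
minus the mean of the negative part. (It is used for functions that are bounded above.) -/
def sphereMean {d : ℕ} (f : Metric.sphere (0 : EuclideanSpace ℝ (Fin d)) 1 → EReal) : EReal :=
  ((⨍⁻ x, (f x).toENNReal ∂(sphereMeasure d) : ENNReal) : EReal) -
    ((⨍⁻ x, (-f x).toENNReal ∂(sphereMeasure d) : ENNReal) : EReal)

/-- The entropy `E_α(Ω, z₀)` with respect to a point `z₀ ∈ Ω`. On the boundary of `Ω` the function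
`u_{z₀} ≥ 0` may vanish and the mean of `u_{z₀} ^ (1 - 1/α)` may be infinite, so the
value is an extended real, with `0 ^ s = ∞` for `s < 0`, `log 0 = -∞` and `log ∞ = ∞`. -/
def entropyAt {d : ℕ} (α : ℝ) (Ω : ConvexBody (EuclideanSpace ℝ (Fin d)))
    (z₀ : EuclideanSpace ℝ (Fin d)) : EReal :=
  if α = 1 then
    sphereMean (fun x : Metric.sphere (0 : EuclideanSpace ℝ (Fin d)) 1 =>
      ENNReal.log (ENNReal.ofReal (supportFn Ω z₀ x)))
  else
    ((α / (α - 1) : ℝ) : EReal) * ENNReal.log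
      (⨍⁻ x, ENNReal.ofReal (supportFn Ω z₀ x) ^ (1 - 1 / α) ∂(sphereMeasure d))

/-- The entropy `E_α(Ω) = sup_{z₀ ∈ Ω} E_α(Ω, z₀)`. -/
def entropy {d : ℕ} (α : ℝ) (Ω : ConvexBody (EuclideanSpace ℝ (Fin d))) : EReal :=
  ⨆ z₀ ∈ Ω, entropyAt α Ω z₀

/-- The inner radius `ρ₋(Ω)`: the radius of the biggest ball enclosed by `Ω`. -/
def innerRadius {d : ℕ} (Ω : ConvexBody (EuclideanSpace ℝ (Fin d))) : ℝ :=
  sSup {r : ℝ | 0 ≤ r ∧ ∃ c : EuclideanSpace ℝ (Fin d), Metric.closedBall c r ⊆ Ω}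

/-- The outer radius `ρ₊(Ω)`: the radius of the smallest ball containing `Ω`. -/
def outerRadius {d : ℕ} (Ω : ConvexBody (EuclideanSpace ℝ (Fin d))) : ℝ :=
  sInf {r : ℝ | 0 ≤ r ∧ ∃ c : EuclideanSpace ℝ (Fin d),
    (Ω : Set (EuclideanSpace ℝ (Fin d))) ⊆ Metric.closedBall c r}

/-- The width `w(x) = u_{z₀}(x) + u_{z₀}(-x)`. It does not depend on `z₀`; we take `z₀ = 0`. -/
def width {d : ℕ} (Ω : ConvexBody (EuclideanSpace ℝ (Fin d)))
    (x : EuclideanSpace ℝ (Fin d)) : ℝ :=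
  supportFn Ω 0 x + supportFn Ω 0 (-x)

/-- The maximal width `w₊(Ω)` over all unit directions. -/
def maxWidth {d : ℕ} (Ω : ConvexBody (EuclideanSpace ℝ (Fin d))) : ℝ :=
  sSup (width Ω '' Metric.sphere 0 1)

/-- The minimal width `w₋(Ω)` over all unit directions. -/
def minWidth {d : ℕ} (Ω : ConvexBody (EuclideanSpace ℝ (Fin d))) : ℝ :=
  sInf (width Ω '' Metric.sphere 0 1)

end ConvexEntropy

end

/-! Write `d = n + 1`. Up to factors depending only on `d`, a convex body is a box with orthonormal
axes `b i` and half-axes `a i`. Its support function from the centre is then comparable to `h(x) =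
max_i a i * |⟨b i, x⟩|`, and from any other point of the body it is at most a constant times `h`.
The volume normalization pins `∏ a i` between two positive constants.

For `p > 0`, integration along rays gives `∫_S h^(-p) = p ∫_{h ≤ 1} |y|^(p-d) dy`, an integral over
the polar box with half-axes `1 / a i`. Since `|y| ≥ |⟨b j, y⟩|`, replacing `|y|` by one coordinate
bounds it from above when `d - 1 < p ≤ d` and from below when `p ≥ d`. The integral then factors and
equals a constant times `(∏ a i)⁻¹ * a j ^ (d - p)`. Below, `a j` is the least half-axis.

(i) Here `1 / α - 1 < d`. Pick `p` in `(d - 1, d)` with `p ≥ 1 / α - 1`; monotonicity of power means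
bounds the entropy at the centre below by `-((d - p) / p) log (a j)` minus a constant. So `a j` is
at least a constant times `exp (-β E)` with `β = p / (d - p)`, and the volume bounds the other
half-axes by a constant times `a j ^ (-(d - 1))`.

(ii) Here `p = 1 / α - 1 > d`, so the entropy itself is a mean of order `-p`. The coordinate bound
and `a j ≤ ρ₋` give the upper estimate at every base point. For the lower one, take the midpoint of
the box centre and the centre of a nearly maximal inscribed ball: there `u ≥ max (h / 2) (ρ₋ / 4)`,
whence `u^(-p) ≤ (ρ₋ / 4)^(d-p) * (h / 2)^(-d)`, and the mean of `h^(-d)` depends only on the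
volume. -/

/-! ### Boxes comparable to a convex set -/

/-- Induction on dimension: the first axis is the direction of a diameter, the others come from the
projection of `K` to its orthogonal complement. Quantifying over all spaces `E` lets the induction
hypothesis apply to that hyperplane. -/
theorem exists_orthonormal_frame (d : ℕ) : ∀ (E : Type) [NormedAddCommGroup E]
    [InnerProductSpace ℝ E] [FiniteDimensional ℝ E], Module.finrank ℝ E = d →
    ∀ K : Set E, IsCompact K → Convex ℝ K → K.Nonempty →
    ∃ b : Fin d → E, Orthonormal ℝ b ∧ ∃ a : Fin d → ℝ, ∃ z ∈ K, ∀ i, 0 ≤ a i ∧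
      z + a i • b i ∈ K ∧ z - a i • b i ∈ K ∧
      ∀ y ∈ K, |inner ℝ (b i) (y - z)| ≤ 5 ^ d * a i := by
  induction d with
  | zero =>
    intro E _ _ _ _ K _ _ ⟨z, hz⟩
    exact ⟨Fin.elim0, ⟨fun i => i.elim0, fun i => i.elim0⟩, Fin.elim0, z, hz, fun i => i.elim0⟩
  | succ d ih =>
    intro E _ _ _ hE K hK hconv hne
    obtain ⟨⟨x, y⟩, ⟨hx, hy⟩, hmax⟩ := (hK.prod hK).exists_isMaxOn (hne.prod hne)
      (f := fun p : E × E => dist p.1 p.2) (by fun_prop)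
    have hdist : ∀ p ∈ K, ∀ q ∈ K, dist p q ≤ dist x y :=
      fun p hp q hq => hmax (Set.mk_mem_prod hp hq)
    rcases eq_or_ne x y with rfl | hxy
    · have hs : ∀ p ∈ K, p = x := fun p hp => by
        simpa using hdist p hp x hx
      have b := (stdOrthonormalBasis ℝ E).reindex (finCongr hE)
      refine ⟨b, b.orthonormal, 0, x, hx, fun i => ⟨le_rfl, by simpa, by simpa, ?_⟩⟩
      intro p hp
      simp [hs p hp]
    set L := ‖y - x‖ with hL
    have hLpos : 0 < L := norm_pos_iff.2 (sub_ne_zero.2 hxy.symm)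
    set e : E := L⁻¹ • (y - x) with he
    have hLe : L • e = y - x := by rw [he, smul_inv_smul₀ hLpos.ne']
    have henorm : ‖e‖ = 1 := by
      rw [he, norm_smul, norm_inv, Real.norm_of_nonneg hLpos.le, ← hL, inv_mul_cancel₀ hLpos.ne']
    have hee : inner ℝ e e = (1 : ℝ) := by rw [real_inner_self_eq_norm_sq, henorm]; norm_num
    set m : E := (1 / 2 : ℝ) • (x + y) with hm
    have hmx : x = m - (L / 2) • e := by
      have : (L / 2) • e = (1 / 2 : ℝ) • (y - x) := by rw [← hLe]; module
      rw [this, hm]; module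
    have hmy : y = m + (L / 2) • e := by
      have : (L / 2) • e = (1 / 2 : ℝ) • (y - x) := by rw [← hLe]; module
      rw [this, hm]; module
    have hmK : m ∈ K := by
      have := hconv hx hy (a := 1 / 2) (b := 1 / 2) (by norm_num) (by norm_num) (by norm_num)
      rwa [← smul_add] at this
    -- A point of `K` is within the diameter `L` of both endpoints, so its `e`-coordinate lies
    -- between theirs.
    have hdm : ∀ q ∈ K, |inner ℝ e (q - m)| ≤ L / 2 := by
      intro q hq
      have h1 : |inner ℝ e (q - x)| ≤ L := by
        refine (abs_real_inner_le_norm _ _).trans ?_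
        rw [henorm, one_mul, ← dist_eq_norm, hL, ← dist_eq_norm, dist_comm y]
        exact hdist q hq x hx
      have h2 : |inner ℝ e (q - y)| ≤ L := by
        refine (abs_real_inner_le_norm _ _).trans ?_
        rw [henorm, one_mul, ← dist_eq_norm, hL, ← dist_eq_norm, dist_comm y]
        exact hdist q hq y hy
      rw [hmx] at h1
      rw [hmy] at h2
      simp only [inner_sub_right, inner_add_right, inner_smul_right, hee] at h1 h2 ⊢
      rw [abs_le] at h1 h2 ⊢
      constructor <;> linarith
    have hseg : ∀ τ : ℝ, |τ| ≤ L / 2 → m + τ • e ∈ K := by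
      intro τ hτ
      rw [abs_le] at hτ
      have := hconv hx hy (a := 1 / 2 - τ / L) (b := 1 / 2 + τ / L)
        (by rw [sub_nonneg, div_le_iff₀ hLpos]; linarith)
        (by have : -(1 / 2) ≤ τ / L := by
              rw [le_div_iff₀ hLpos]; linarith
            linarith) (by ring)
      convert this using 1
      rw [hmx, hmy]
      have h3 : τ = 2 * (τ / L) * (L / 2) := by field_simp
      conv_lhs => rw [h3]
      module
    set F := (ℝ ∙ e)ᗮ with hF
    have : Fact (Module.finrank ℝ E = d + 1) := ⟨hE⟩
    have hFd : Module.finrank ℝ F = d := by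
      apply Submodule.finrank_orthogonal_span_singleton
      rw [← norm_ne_zero_iff, henorm]; norm_num
    set π : E →L[ℝ] F := F.orthogonalProjectionOnto with hπ
    have hπe : ∀ q : E, (π q : E) = q - (inner ℝ e q : ℝ) • e := by
      intro q
      have := Submodule.starProjection_unit_singleton ℝ henorm q
      have h2 := Submodule.starProjection_add_starProjection_orthogonal (K := (ℝ ∙ e)) q
      rw [this] at h2
      rw [eq_sub_iff_add_eq, add_comm]
      exact h2
    have hFe : ∀ f : F, inner ℝ e (f : E) = (0 : ℝ) := fun f =>
      Submodule.mem_orthogonal_singleton_iff_inner_right.1 f.2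
    have hFe' : ∀ f : F, inner ℝ (f : E) e = (0 : ℝ) := fun f => by
      rw [real_inner_comm]; exact hFe f
    obtain ⟨b, hb, a, z, ⟨z₀, hz₀, hz₀z⟩, hall⟩ := ih F hFd (π '' K) (hK.image π.continuous)
      (hconv.is_linear_image π.toLinearMap.isLinear) (hne.image _)
    set t : E := (1 / 3 : ℝ) • (z : E) + (2 / 3 : ℝ) • (π m : E) + (inner ℝ e m : ℝ) • e with ht
    -- Contracting the projection by 1/3 towards `π m` leaves room to correct heights: a lift `q` of
    -- `w` is averaged with a point of the diameter, weights 1/3 and 2/3.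
    have key : ∀ w ∈ π '' K, ∀ δ : ℝ, |δ| ≤ L / 6 →
        (1 / 3 : ℝ) • (w : E) + (2 / 3 : ℝ) • (π m : E) + (inner ℝ e m : ℝ) • e + δ • e ∈ K := by
      rintro _ ⟨q, hq, rfl⟩ δ hδ
      have h1 := hdm q hq
      -- Solves `⟨e, q - m⟩ / 3 + 2 τ / 3 = δ`; the bound `L / 6` on `δ` is what makes `|τ| ≤ L /
      -- 2`.
      set τ := (3 * δ - inner ℝ e (q - m)) / 2 with hτ
      have h2 : |τ| ≤ L / 2 := by
        rw [abs_le] at hδ h1 ⊢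
        constructor <;> linarith
      have := hconv hq (hseg τ h2) (a := 1 / 3) (b := 2 / 3)
        (by norm_num) (by norm_num) (by norm_num)
      convert this using 1
      rw [hπe, hπe, hτ, inner_sub_right]
      module
    have htz : t ∈ K := by
      have := key z ⟨z₀, hz₀, hz₀z⟩ 0 (by rw [abs_zero]; positivity)
      simpa [ht] using this
    refine ⟨Fin.cons e (fun i => (b i : E)), ?_, Fin.cons (L / 6) (fun i => a i / 3), t, htz, ?_⟩
    · constructor
      · intro i
        refine Fin.cases ?_ (fun i => ?_) i
        · simpa using henorm
        · simpa using hb.1 i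
      · intro i j
        refine Fin.cases ?_ (fun i => ?_) i
        · refine Fin.cases ?_ (fun j => ?_) j
          · intro h; exact absurd rfl h
          · intro _; simpa using hFe (b j)
        · refine Fin.cases ?_ (fun j => ?_) j
          · intro _; simpa using hFe' (b i)
          · intro h
            simpa using hb.2 (fun h' => h (by rw [h']))
    · intro i
      refine Fin.cases ?_ (fun i => ?_) i
      · simp only [Fin.cons_zero]
        refine ⟨by positivity, ?_, ?_, ?_⟩
        · exact key z ⟨z₀, hz₀, hz₀z⟩ (L / 6) (abs_of_pos (by positivity)).le
        · have := key z ⟨z₀, hz₀, hz₀z⟩ (-(L / 6)) (by rw [abs_neg]; exact (abs_of_pos (by positivity)).le)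
          rwa [neg_smul, ← sub_eq_add_neg] at this
        · intro q hq
          have h1 := hdm q hq
          have h2 : inner ℝ e (q - t) = inner ℝ e (q - m) := by
            rw [ht]
            simp only [inner_sub_right, inner_add_right, inner_smul_right, hee, hFe]
            ring
          rw [h2]
          refine h1.trans ?_
          have : (1 : ℝ) ≤ 5 ^ d := one_le_pow₀ (by norm_num)
          rw [pow_succ]
          nlinarith
      · obtain ⟨ha, hp, hn, hyy⟩ := hall i
        simp only [Fin.cons_succ]
        refine ⟨by positivity, ?_, ?_, ?_⟩
        · have := key _ hp 0 (by rw [abs_zero]; positivity)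
          convert this using 1
          rw [ht]
          push_cast
          module
        · have := key _ hn 0 (by rw [abs_zero]; positivity)
          convert this using 1
          rw [ht]
          push_cast
          module
        · intro q hq
          have h1 := hyy _ (Set.mem_image_of_mem π hq)
          have h2 := hyy _ (Set.mem_image_of_mem π hmK)
          -- The two terms contribute `(1 + 2 / 3) * 5 ^ d * a i = 5 ^ (d + 1) * (a i / 3)`, the
          -- source of the factor 5 per dimension.
          have h3 : inner ℝ (b i : E) (q - t) =
              inner ℝ (b i) (π q - z) - 2 / 3 * inner ℝ (b i) (π m - z) := by
            rw [ht, Submodule.coe_inner, Submodule.coe_inner]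
            push_cast
            rw [hπe q]
            simp only [inner_sub_right, inner_add_right, inner_smul_right, hFe']
            ring
          rw [h3]
          rw [abs_le] at h1 h2 ⊢
          rw [pow_succ]
          constructor <;> nlinarith

theorem exists_box_frame {d : ℕ} (K : Set (EuclideanSpace ℝ (Fin d))) (hK : IsCompact K)
    (hconv : Convex ℝ K) (hne : K.Nonempty) :
    ∃ (b : OrthonormalBasis (Fin d) ℝ (EuclideanSpace ℝ (Fin d))) (a : Fin d → ℝ)
      (z : EuclideanSpace ℝ (Fin d)), z ∈ K ∧ (∀ i, 0 ≤ a i) ∧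
      (∀ y, (∀ i, |inner ℝ (b i) (y - z)| ≤ a i) → y ∈ K) ∧
      ∀ y ∈ K, ∀ i, |inner ℝ (b i) (y - z)| ≤ 5 ^ d * d * a i := by
  rcases Nat.eq_zero_or_pos d with rfl | hd
  · obtain ⟨z, hz⟩ := hne
    refine ⟨EuclideanSpace.basisFun _ ℝ, 0, z, hz, fun i => i.elim0, fun y _ => ?_,
      fun y _ i => i.elim0⟩
    rwa [Subsingleton.elim y z]
  obtain ⟨b, hb, a, z, hz, hall⟩ := exists_orthonormal_frame d (EuclideanSpace ℝ (Fin d))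
    (by simp) K hK hconv hne
  have : Nonempty (Fin d) := ⟨⟨0, hd⟩⟩
  have hspan : ⊤ ≤ Submodule.span ℝ (Set.range b) := by
    rw [← coe_basisOfOrthonormalOfCardEqFinrank hb (by simp)]
    exact (Module.Basis.span_eq _).ge
  have hd' : (0 : ℝ) < d := by exact_mod_cast hd
  refine ⟨OrthonormalBasis.mk hb hspan, fun i => a i / d, z, hz,
    fun i => div_nonneg (hall i).1 hd'.le, ?_, ?_⟩
  · intro y hy
    -- The convex hull of the axis segments contains the box shrunk by `d`: `y` is the average of
    -- `d` points, one on each axis through `z`.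
    have hsum : y = ∑ i, (1 / d : ℝ) • (z + (d * inner ℝ (b i) (y - z)) • b i) := by
      have := (OrthonormalBasis.mk hb hspan).sum_repr' (y - z)
      simp only [OrthonormalBasis.coe_mk] at this
      simp only [smul_add, Finset.sum_add_distrib, Finset.sum_const, Finset.card_univ,
        Fintype.card_fin, smul_smul]
      rw [← Nat.cast_smul_eq_nsmul ℝ, smul_smul, mul_one_div_cancel hd'.ne', one_smul]
      simp only [← mul_assoc, one_div_mul_cancel hd'.ne', one_mul]
      rw [this]; abel
    rw [hsum]
    refine hconv.sum_mem (fun _ _ => by positivity) (by simp [hd'.ne']) fun i _ => ?_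
    obtain ⟨ha, hp, hn, -⟩ := hall i
    have h1 := hy i
    simp only [OrthonormalBasis.coe_mk] at h1
    rw [le_div_iff₀ hd', mul_comm, ← abs_of_pos hd', ← abs_mul] at h1
    set u := d * inner ℝ (b i) (y - z)
    rcases ha.eq_or_lt with h0 | h0
    · rw [← h0] at h1
      have : u = 0 := abs_nonpos_iff.1 h1
      simpa [this] using hz
    · rw [abs_le] at h1
      have h4 : -1 ≤ u / a i := by rw [le_div_iff₀ h0]; linarith
      have h5 : u / a i ≤ 1 := by rw [div_le_iff₀ h0]; linarith
      have := hconv hp hn (a := (1 + u / a i) / 2) (b := (1 - u / a i) / 2)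
        (by linarith) (by linarith) (by ring)
      convert this using 1
      have h3 : u = (u / a i) * a i := by field_simp
      conv_lhs => rw [h3]
      module
  · intro y hy i
    simp only [OrthonormalBasis.coe_mk]
    refine ((hall i).2.2.2 y hy).trans (le_of_eq ?_)
    field_simp

/-! ### Integrals of a power of one coordinate over a box -/

theorem integrable_indicator_abs_rpow {r q : ℝ} (hq : -1 < q) :
    Integrable (fun t : ℝ => (Set.Iic r).indicator (fun t => t ^ q) |t|) := by
  have h1 : IntegrableOn (fun t : ℝ => (Set.Iic r).indicator (fun t => t ^ q) |t|)
      (Set.Ioi 0) := by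
    have h2 : IntegrableOn ((Set.Iic r).indicator (fun t : ℝ => t ^ q)) (Set.Ioi 0) := by
      rw [IntegrableOn, integrable_indicator_iff measurableSet_Iic, IntegrableOn,
        Measure.restrict_restrict measurableSet_Iic, Set.inter_comm, Set.Ioi_inter_Iic]
      exact (intervalIntegral.intervalIntegrable_rpow' hq (a := 0) (b := r)).1
    refine h2.congr_fun (fun t ht => ?_) measurableSet_Ioi
    simp only [abs_of_pos (Set.mem_Ioi.1 ht)]
  have h3 : IntegrableOn (fun t : ℝ => (Set.Iic r).indicator (fun t => t ^ q) |t|)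
      (Set.Iic 0) := by
    rw [← Measure.map_neg_eq_self (volume : Measure ℝ)]
    let m : MeasurableEmbedding fun x : ℝ => -x := (Homeomorph.neg ℝ).measurableEmbedding
    rw [m.integrableOn_map_iff]
    simp_rw [Function.comp_def, abs_neg, Set.neg_preimage, Set.neg_Iic, neg_zero]
    exact Iff.mpr integrableOn_Ici_iff_integrableOn_Ioi h1
  have h4 := h3.union h1
  rwa [Set.Iic_union_Ioi, integrableOn_univ] at h4

theorem integral_indicator_abs_rpow {r q : ℝ} (hr : 0 < r) (hq : -1 < q) :
    ∫ t : ℝ, (Set.Iic r).indicator (fun t => t ^ q) |t| = 2 * r ^ (q + 1) / (q + 1) := by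
  rw [integral_comp_abs, integral_indicator measurableSet_Iic,
    Measure.restrict_restrict measurableSet_Iic, Set.inter_comm, Set.Ioi_inter_Iic,
    ← intervalIntegral.integral_of_le hr.le, integral_rpow (Or.inl hq),
    Real.zero_rpow (by linarith)]
  ring

section Box
variable {d : ℕ} (b : OrthonormalBasis (Fin d) ℝ (EuclideanSpace ℝ (Fin d)))

theorem measurePreserving_coords :
    MeasurePreserving (fun (y : EuclideanSpace ℝ (Fin d)) (i : Fin d) => inner ℝ (b i) y)
      volume volume := by
  have := (PiLp.volume_preserving_ofLp (Fin d)).comp b.measurePreserving_repr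
  have h : (fun (y : EuclideanSpace ℝ (Fin d)) (i : Fin d) => inner ℝ (b i) y) =
      WithLp.ofLp ∘ b.repr := by
    funext y i
    simp [b.repr_apply_apply]
  rw [h]
  exact this

theorem setLIntegral_box (r : Fin d → ℝ) (hr : ∀ i, 0 < r i) (j : Fin d) {q : ℝ} (hq : -1 < q) :
    ∫⁻ y in {y | ∀ i, |inner ℝ (b i) y| ≤ r i}, ENNReal.ofReal |inner ℝ (b j) y| ^ q =
      ENNReal.ofReal (2 ^ d * (∏ i, r i) * r j ^ q / (q + 1)) := by
  set Q : Fin d → ℝ := fun i => if i = j then q else 0 with hQ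
  have hQ1 : ∀ i, -1 < Q i := fun i => by
    simp only [hQ]; split_ifs <;> linarith
  set S : Set (Fin d → ℝ) := {x | ∀ i, |x i| ≤ r i} with hS
  have hSm : MeasurableSet S := by
    rw [hS, Set.ofPred_forall]
    exact MeasurableSet.iInter fun i => measurableSet_le (by fun_prop) (by fun_prop)
  set G : (Fin d → ℝ) → ENNReal := S.indicator fun x => ENNReal.ofReal |x j| ^ q with hG
  have hGm : Measurable G := by
    refine Measurable.indicator ?_ hSm
    fun_prop
  have hmp := measurePreserving_coords b
  have h1 : ∫⁻ y in {y | ∀ i, |inner ℝ (b i) y| ≤ r i}, ENNReal.ofReal |inner ℝ (b j) y| ^ q =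
      ∫⁻ x, G x := by
    have hm : MeasurableSet {y | ∀ i, |inner ℝ (b i) y| ≤ r i} := hmp.measurable hSm
    rw [← hmp.lintegral_comp hGm, ← lintegral_indicator hm]
    rfl
  have h2 : G =ᵐ[volume] fun x => ENNReal.ofReal
      (∏ i, (Set.Iic (r i)).indicator (fun t => t ^ Q i) |x i|) := by
    -- On the null hyperplane `x j = 0` the extended power is `∞` for `q < 0`, while the real power
    -- is `0`.
    filter_upwards [Measure.ae_eval_ne (μ := fun _ : Fin d => (volume : Measure ℝ)) j 0] with x hx
    by_cases hxS : x ∈ S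
    · have : ∀ i, (Set.Iic (r i)).indicator (fun t => t ^ Q i) |x i| = |x i| ^ Q i := fun i =>
        Set.indicator_of_mem (Set.mem_Iic.2 (hxS i)) _
      simp only [this, hG, Set.indicator_of_mem hxS]
      rw [Finset.prod_eq_single j (fun i _ hi => by simp [hQ, hi]) (by simp)]
      simp only [hQ, if_true]
      rw [ENNReal.ofReal_rpow_of_pos (abs_pos.2 hx)]
    · rw [hG, Set.indicator_of_notMem hxS]
      simp only [hS, Set.mem_ofPred_eq, not_forall] at hxS
      obtain ⟨i, hi⟩ := hxS
      rw [Finset.prod_eq_zero (Finset.mem_univ i) (Set.indicator_of_notMem (mt Set.mem_Iic.1 hi) _)]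
      simp
  rw [h1, lintegral_congr_ae h2, ← ofReal_integral_eq_lintegral_ofReal]
  · rw [integral_fintype_prod_volume_eq_prod
      (fun i t => (Set.Iic (r i)).indicator (fun t => t ^ Q i) |t|)]
    simp only [integral_indicator_abs_rpow (hr _) (hQ1 _)]
    congr 1
    have h3 : ∀ i, 2 * r i ^ (Q i + 1) / (Q i + 1) =
        2 * r i * (if i = j then r j ^ q / (q + 1) else 1) := fun i => by
      rw [Real.rpow_add_one (hr i).ne']
      simp only [hQ]
      split_ifs with h
      · subst h; ring
      · simp
    simp only [h3, Finset.prod_mul_distrib, Finset.prod_ite_eq', Finset.mem_univ, if_true,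
      Finset.prod_const, Finset.card_univ, Fintype.card_fin]
    ring
  · exact Integrable.fintype_prod
      (f := fun i t => (Set.Iic (r i)).indicator (fun t => t ^ Q i) |t|)
      (fun i => integrable_indicator_abs_rpow (hQ1 i))
  · exact Filter.Eventually.of_forall fun x => Finset.prod_nonneg fun i _ =>
      Set.indicator_apply_nonneg (fun _ => by positivity)

theorem volume_box (c : EuclideanSpace ℝ (Fin d)) (r : Fin d → ℝ) (hr : ∀ i, 0 ≤ r i) :
    volume {y | ∀ i, |inner ℝ (b i) (y - c)| ≤ r i} = ENNReal.ofReal (2 ^ d * ∏ i, r i) := by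
  have h1 : volume {y | ∀ i, |inner ℝ (b i) (y - c)| ≤ r i} =
      volume {y | ∀ i, |inner ℝ (b i) y| ≤ r i} := by
    have := measure_preimage_add_right volume (-c) {y | ∀ i, |inner ℝ (b i) y| ≤ r i}
    rw [← this]
    simp only [← sub_eq_add_neg]
    rfl
  have h2 : {y | ∀ i, |inner ℝ (b i) y| ≤ r i} =
      (fun (y : EuclideanSpace ℝ (Fin d)) (i : Fin d) => inner ℝ (b i) y) ⁻¹'
        Set.univ.pi (fun i => Set.Icc (-r i) (r i)) := by
    ext y; simp [abs_le, Pi.le_def, forall_and]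
  rw [h1, h2, (measurePreserving_coords b).measure_preimage
    (MeasurableSet.univ_pi fun i => measurableSet_Icc).nullMeasurableSet, volume_pi_pi]
  simp only [Real.volume_Icc]
  rw [← ENNReal.ofReal_prod_of_nonneg (fun i _ => by linarith [hr i])]
  simp only [sub_neg_eq_add, ← two_mul, Finset.prod_mul_distrib, Finset.prod_const,
    Finset.card_univ, Fintype.card_fin]

end Box

/-! ### Polar coordinates -/

theorem lintegral_volumeIoiPow (n : ℕ) (G : ℝ → ENNReal) (hG : Measurable G) :
    ∫⁻ r : Set.Ioi (0 : ℝ), G r ∂(Measure.volumeIoiPow n) =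
      ∫⁻ r in Set.Ioi (0 : ℝ), ENNReal.ofReal (r ^ n) * G r := by
  rw [Measure.volumeIoiPow, lintegral_withDensity_eq_lintegral_mul _ (by fun_prop)
    (show Measurable fun r : Set.Ioi (0 : ℝ) => G r from hG.comp measurable_subtype_coe),
    ← lintegral_subtype_comap measurableSet_Ioi fun r => ENNReal.ofReal (r ^ n) * G r]
  rfl

theorem lintegral_eq_lintegral_sphere {E : Type*} [NormedAddCommGroup E] [NormedSpace ℝ E]
    [FiniteDimensional ℝ E] [Nontrivial E] [MeasurableSpace E] [BorelSpace E] (μ : Measure E)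
    [μ.IsAddHaarMeasure] (f : E → ENNReal) (hf : Measurable f) :
    ∫⁻ y, f y ∂μ = ∫⁻ x : Metric.sphere (0 : E) 1, (∫⁻ r in Set.Ioi (0 : ℝ),
      ENNReal.ofReal (r ^ (Module.finrank ℝ E - 1)) * f (r • (x : E))) ∂μ.toSphere := by
  have h1 : ∫⁻ y, f y ∂μ = ∫⁻ y : ({(0)}ᶜ : Set E), f y ∂(μ.comap (↑)) := by
    rw [lintegral_subtype_comap (measurableSet_singleton _).compl f,
      restrict_compl_singleton]
  have h2 := μ.measurePreserving_homeomorphUnitSphereProd.lintegral_comp_emb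
    (Homeomorph.measurableEmbedding _)
    (fun p : Metric.sphere (0 : E) 1 × Set.Ioi (0 : ℝ) => f ((p.2 : ℝ) • (p.1 : E)))
  have hm : Measurable
      (fun p : Metric.sphere (0 : E) 1 × Set.Ioi (0 : ℝ) => f ((p.2 : ℝ) • (p.1 : E))) := by
    fun_prop
  rw [h1, ← lintegral_congr (fun x : Metric.sphere (0 : E) 1 => lintegral_volumeIoiPow _ (fun r => f (r • (x : E)))
    (by fun_prop)), ← lintegral_prod _ hm.aemeasurable, ← h2]
  refine lintegral_congr fun y => ?_
  have : ‖(y : E)‖ ≠ 0 := norm_ne_zero_iff.2 y.2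
  simp [smul_smul, this]

/-- By homogeneity the ray through `x` meets `{h ≤ 1}` in `0 < r ≤ 1 / h x`, and `p * ∫ r ^ (p - 1)`
over that range is `h x ^ (-p)`. -/
theorem lintegral_sphere_rpow_neg {E : Type*} [NormedAddCommGroup E] [NormedSpace ℝ E]
    [FiniteDimensional ℝ E] [Nontrivial E] [MeasurableSpace E] [BorelSpace E] (μ : Measure E)
    [μ.IsAddHaarMeasure] (h : E → ℝ) (hm : Measurable h)
    (hh : ∀ t : ℝ, 0 < t → ∀ x, h (t • x) = t * h x)
    (hpos : ∀ x ∈ Metric.sphere (0 : E) 1, 0 < h x) {p : ℝ} (hp : 0 < p) :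
    ∫⁻ x : Metric.sphere (0 : E) 1, ENNReal.ofReal (h x) ^ (-p) ∂μ.toSphere =
      ENNReal.ofReal p *
        ∫⁻ y in {y | h y ≤ 1}, ENNReal.ofReal ‖y‖ ^ (p - Module.finrank ℝ E) ∂μ := by
  have hS : MeasurableSet {y | h y ≤ 1} := measurableSet_le hm measurable_const
  have hd : 0 < Module.finrank ℝ E := Module.finrank_pos
  rw [← lintegral_indicator hS, lintegral_eq_lintegral_sphere μ _
    (Measurable.indicator (by fun_prop) hS), ← lintegral_const_mul' _ _ ENNReal.ofReal_ne_top]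
  refine lintegral_congr fun x => ?_
  have hx := hpos x x.2
  have hxn : ‖(x : E)‖ = 1 := by simp
  have h1 : ∫⁻ r in Set.Ioi (0 : ℝ), ENNReal.ofReal (r ^ (Module.finrank ℝ E - 1)) *
      {y | h y ≤ 1}.indicator
        (fun y => ENNReal.ofReal ‖y‖ ^ (p - Module.finrank ℝ E)) (r • (x : E)) =
      ∫⁻ r in Set.Ioc (0 : ℝ) (h x)⁻¹, ENNReal.ofReal (r ^ (p - 1)) := by
    rw [← lintegral_indicator measurableSet_Ioi, ← lintegral_indicator measurableSet_Ioc]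
    refine lintegral_congr fun r => ?_
    by_cases hr : 0 < r
    · rw [Set.indicator_of_mem (Set.mem_Ioi.2 hr)]
      by_cases hr2 : r ≤ (h x)⁻¹
      · have hmem : r • (x : E) ∈ {y | h y ≤ 1} := by
          rw [Set.mem_ofPred_eq, hh r hr]
          exact (le_inv_mul_iff₀ hx).1 (by simpa using hr2) |>.trans_eq' (mul_comm _ _)
        rw [Set.indicator_of_mem hmem, Set.indicator_of_mem (Set.mem_Ioc.2 ⟨hr, hr2⟩), norm_smul, hxn, mul_one,
          Real.norm_of_nonneg hr.le, ENNReal.ofReal_rpow_of_pos hr,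
          ← ENNReal.ofReal_mul (by positivity), ← Real.rpow_natCast, ← Real.rpow_add hr,
          Nat.cast_sub hd]
        congr 2
        push_cast; ring
      · have hmem : r • (x : E) ∉ {y | h y ≤ 1} := by
          rw [Set.mem_ofPred_eq, hh r hr, not_le]
          rw [not_le, inv_lt_iff_one_lt_mul₀ hx] at hr2
          linarith
        rw [Set.indicator_of_notMem hmem, Set.indicator_of_notMem (fun hc => hr2 (Set.mem_Ioc.1 hc).2), mul_zero]
    · rw [Set.indicator_of_notMem (mt Set.mem_Ioi.1 hr),
        Set.indicator_of_notMem (fun hc => hr (Set.mem_Ioc.1 hc).1)]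
  have hinv : 0 < (h x)⁻¹ := inv_pos.2 hx
  rw [h1, ← ofReal_integral_eq_lintegral_ofReal, ← intervalIntegral.integral_of_le hinv.le,
    integral_rpow (Or.inl (by linarith)), sub_add_cancel, Real.zero_rpow hp.ne',
    ENNReal.ofReal_rpow_of_pos hx, ← ENNReal.ofReal_mul hp.le, Real.inv_rpow hx.le,
    Real.rpow_neg hx.le]
  · congr 1; field_simp; ring
  · exact (intervalIntegral.intervalIntegrable_rpow' (by linarith)).1
  · filter_upwards [ae_restrict_mem measurableSet_Ioc] with r hr
    exact Real.rpow_nonneg hr.1.le _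

/-! ### Power mean inequalities -/

section PowerMean
variable {X : Type*} [TopologicalSpace X] [CompactSpace X] [MeasurableSpace X] [BorelSpace X]
  (ν : Measure X) [IsProbabilityMeasure ν] {H : X → ℝ}

theorem integrable_rpow_of_continuous (hH : Continuous H) (hpos : ∀ x, 0 < H x) (s : ℝ) :
    Integrable (fun x => H x ^ s) ν :=
  (hH.rpow_const fun x => Or.inl (hpos x).ne').integrable_of_hasCompactSupport
    (HasCompactSupport.of_compactSpace _)

theorem integrable_log_of_continuous (hH : Continuous H) (hpos : ∀ x, 0 < H x) :
    Integrable (fun x => Real.log (H x)) ν :=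
  (hH.log fun x => (hpos x).ne').integrable_of_hasCompactSupport
    (HasCompactSupport.of_compactSpace _)

variable {p M : ℝ}

/-- Two instances of `exp t ≥ t + 1`, weighted so that the terms in `log v` cancel. Applied to `v =
H x / M` and integrated, this compares the means of orders `-p` and `s`. -/
theorem one_add_le_rpow_add {v : ℝ} (hv : 0 < v) (hp : 0 < p) {s : ℝ} (hs : 0 < s) :
    1 + s / p ≤ v ^ s + s / p * v ^ (-p) := by
  have h1 := Real.add_one_le_exp (Real.log v * s)
  have h2 := Real.add_one_le_exp (Real.log v * -p)
  rw [← Real.rpow_def_of_pos hv] at h1 h2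
  have h3 := mul_le_mul_of_nonneg_left h2 (div_pos hs hp).le
  have h4 : s / p * (Real.log v * -p + 1) = -(Real.log v * s) + s / p := by field_simp
  linarith

theorem one_sub_rpow_div_le_log {v : ℝ} (hv : 0 < v) (hp : 0 < p) :
    (1 - v ^ (-p)) / p ≤ Real.log v := by
  have h2 := Real.add_one_le_exp (Real.log v * -p)
  rw [← Real.rpow_def_of_pos hv] at h2
  rw [div_le_iff₀ hp]
  linarith

/-- Weighted arithmetic-geometric mean inequality for `v ^ (-p)` and `1`, with weight `-s / p` on
the former. -/
theorem rpow_le_one_add {v : ℝ} (hv : 0 < v) (hp : 0 < p) {s : ℝ} (hs : s ≤ 0) (hps : -p ≤ s) :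
    v ^ s ≤ 1 - s / p * (v ^ (-p) - 1) := by
  have h1 : -s / p ≤ 1 := by rw [div_le_one hp]; linarith
  have := Real.geom_mean_le_arith_mean2_weighted (w₁ := -s / p) (w₂ := 1 - -s / p)
    (p₁ := v ^ (-p)) (p₂ := 1) (div_nonneg (by linarith) hp.le) (by linarith)
    (Real.rpow_nonneg hv.le _) zero_le_one (by ring)
  rw [← Real.rpow_mul hv.le, Real.one_rpow] at this
  have h2 : -p * (-s / p) = s := by field_simp
  rw [h2] at this
  refine (mul_one (v ^ s) ▸ this).trans (le_of_eq ?_)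
  ring

theorem rpow_le_integral_rpow (hH : Continuous H) (hpos : ∀ x, 0 < H x) (hp : 0 < p) (hM : 0 < M)
    (hK : ∫ x, H x ^ (-p) ∂ν ≤ M ^ (-p)) {s : ℝ} (hs : 0 < s) :
    M ^ s ≤ ∫ x, H x ^ s ∂ν := by
  have hi := integrable_rpow_of_continuous ν hH hpos
  have h1 : ∫ x, (1 + s / p) ∂ν ≤
      ∫ x, ((M ^ s)⁻¹ * H x ^ s + s / p * ((M ^ (-p))⁻¹ * H x ^ (-p))) ∂ν := by
    refine integral_mono (integrable_const _)
      (((hi s).const_mul _).add (((hi (-p)).const_mul _).const_mul _)) fun x => ?_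
    have := one_add_le_rpow_add (div_pos (hpos x) hM) hp hs
    rwa [Real.div_rpow (hpos x).le hM.le, Real.div_rpow (hpos x).le hM.le,
      div_eq_inv_mul (H x ^ s), div_eq_inv_mul (H x ^ (-p))] at this
  rw [integral_add ((hi s).const_mul _) (((hi (-p)).const_mul _).const_mul _),
    integral_const_mul, integral_const_mul, integral_const_mul, integral_const,
    probReal_univ, one_smul] at h1
  have h2 : (M ^ (-p))⁻¹ * ∫ x, H x ^ (-p) ∂ν ≤ 1 := by
    rw [inv_mul_le_iff₀ (Real.rpow_pos_of_pos hM _), mul_one]; exact hK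
  have h3 := mul_le_mul_of_nonneg_left h2 (div_pos hs hp).le
  have h4 : 1 ≤ (M ^ s)⁻¹ * ∫ x, H x ^ s ∂ν := by linarith
  rwa [le_inv_mul_iff₀ (Real.rpow_pos_of_pos hM _), mul_one] at h4

theorem log_le_integral_log (hH : Continuous H) (hpos : ∀ x, 0 < H x) (hp : 0 < p) (hM : 0 < M)
    (hK : ∫ x, H x ^ (-p) ∂ν ≤ M ^ (-p)) :
    Real.log M ≤ ∫ x, Real.log (H x) ∂ν := by
  have hi := integrable_rpow_of_continuous ν hH hpos
  have h1 : ∫ x, (Real.log M + 1 / p - 1 / p * ((M ^ (-p))⁻¹ * H x ^ (-p))) ∂ν ≤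
      ∫ x, Real.log (H x) ∂ν := by
    refine integral_mono ((integrable_const _).sub (((hi (-p)).const_mul _).const_mul _))
      (integrable_log_of_continuous ν hH hpos) fun x => ?_
    have := one_sub_rpow_div_le_log (div_pos (hpos x) hM) hp
    rw [Real.div_rpow (hpos x).le hM.le, Real.log_div (hpos x).ne' hM.ne', div_eq_inv_mul (_ ^ _),
      sub_div] at this
    have e : 1 / p * ((M ^ (-p))⁻¹ * H x ^ (-p)) = (M ^ (-p))⁻¹ * H x ^ (-p) / p := by ring
    simp only [e]
    linarith
  rw [integral_sub (integrable_const _) (((hi (-p)).const_mul _).const_mul _),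
    integral_const_mul, integral_const_mul, integral_const, probReal_univ, one_smul] at h1
  have h2 : (M ^ (-p))⁻¹ * ∫ x, H x ^ (-p) ∂ν ≤ 1 := by
    rw [inv_mul_le_iff₀ (Real.rpow_pos_of_pos hM _), mul_one]; exact hK
  have h3 := mul_le_mul_of_nonneg_left h2 (one_div_pos.2 hp).le
  linarith

theorem integral_rpow_le_rpow (hH : Continuous H) (hpos : ∀ x, 0 < H x) (hp : 0 < p) (hM : 0 < M)
    (hK : ∫ x, H x ^ (-p) ∂ν ≤ M ^ (-p)) {s : ℝ} (hs : s ≤ 0) (hps : -p ≤ s) :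
    ∫ x, H x ^ s ∂ν ≤ M ^ s := by
  have hi := integrable_rpow_of_continuous ν hH hpos
  have h1 : ∫ x, (M ^ s)⁻¹ * H x ^ s ∂ν ≤
      ∫ x, (1 + s / p - s / p * ((M ^ (-p))⁻¹ * H x ^ (-p))) ∂ν := by
    refine integral_mono ((hi s).const_mul _)
      ((integrable_const _).sub (((hi (-p)).const_mul _).const_mul _)) fun x => ?_
    have := rpow_le_one_add (div_pos (hpos x) hM) hp hs hps
    rw [Real.div_rpow (hpos x).le hM.le, Real.div_rpow (hpos x).le hM.le,
      div_eq_inv_mul (H x ^ s), div_eq_inv_mul (H x ^ (-p))] at this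
    simp only
    linarith
  rw [integral_sub (integrable_const _) (((hi (-p)).const_mul _).const_mul _),
    integral_const_mul, integral_const_mul, integral_const_mul, integral_const,
    probReal_univ, one_smul] at h1
  have h2 : (M ^ (-p))⁻¹ * ∫ x, H x ^ (-p) ∂ν ≤ 1 := by
    rw [inv_mul_le_iff₀ (Real.rpow_pos_of_pos hM _), mul_one]; exact hK
  have h3 := mul_le_mul_of_nonneg_left h2 (div_nonneg (neg_nonneg.2 hs) hp.le)
  have h5 : -s / p = -(s / p) := by ring
  rw [h5] at h3
  have h4 : (M ^ s)⁻¹ * ∫ x, H x ^ s ∂ν ≤ 1 := by linarith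
  rwa [inv_mul_le_iff₀ (Real.rpow_pos_of_pos hM _), mul_one] at h4

theorem lintegral_ofReal_rpow (hH : Continuous H) (hpos : ∀ x, 0 < H x) (s : ℝ) :
    ∫⁻ x, ENNReal.ofReal (H x) ^ s ∂ν = ENNReal.ofReal (∫ x, H x ^ s ∂ν) := by
  rw [ofReal_integral_eq_lintegral_ofReal (integrable_rpow_of_continuous ν hH hpos s)
    (Filter.Eventually.of_forall fun x => Real.rpow_nonneg (hpos x).le _)]
  exact lintegral_congr fun x => ENNReal.ofReal_rpow_of_pos (hpos x)

end PowerMean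

/-! ### Entropy bounds from means of negative powers -/

theorem EReal.coe_mul_le_coe_mul_of_nonpos {c : ℝ} (hc : c ≤ 0) {x y : EReal} (h : x ≤ y) :
    (c : EReal) * y ≤ c * x := by
  have h1 : ((-c : ℝ) : EReal) * x ≤ ((-c : ℝ) : EReal) * y :=
    mul_le_mul_of_nonneg_left h (by exact_mod_cast neg_nonneg.2 hc)
  rw [EReal.coe_neg, neg_mul, neg_mul] at h1
  exact EReal.neg_le_neg_iff.1 h1

namespace ConvexEntropy

theorem ofReal_rpow_le_ofReal_rpow_of_nonpos {x y s : ℝ} (h : x ≤ y) (hs : s ≤ 0) :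
    ENNReal.ofReal y ^ s ≤ ENNReal.ofReal x ^ s := by
  rw [← neg_neg s, ENNReal.rpow_neg, ENNReal.rpow_neg _ (-s)]
  exact ENNReal.inv_le_inv.2
    (ENNReal.rpow_le_rpow (ENNReal.ofReal_le_ofReal h) (neg_nonneg.2 hs))

theorem log_ofReal_rpow {M : ℝ} (hM : 0 < M) (s : ℝ) :
    ENNReal.log (ENNReal.ofReal (M ^ s)) = ((s * Real.log M : ℝ) : EReal) := by
  rw [ENNReal.log_ofReal_of_pos (Real.rpow_pos_of_pos hM _), Real.log_rpow hM]

variable {d : ℕ} {α : ℝ} {Ω : ConvexBody (EuclideanSpace ℝ (Fin d))}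
  {z : EuclideanSpace ℝ (Fin d)}

instance : IsFiniteMeasure (sphereMeasure d) := by
  unfold sphereMeasure; infer_instance

instance [NeZero d] : NeZero (sphereMeasure d) := by
  unfold sphereMeasure
  have : Nontrivial (EuclideanSpace ℝ (Fin d)) := by
    apply Module.nontrivial_of_finrank_pos (R := ℝ)
    simpa using Nat.pos_of_ne_zero (NeZero.ne d)
  exact ⟨Measure.toSphere_ne_zero _⟩

theorem sphereMean_mono {f g : Metric.sphere (0 : EuclideanSpace ℝ (Fin d)) 1 → EReal}
    (h : ∀ x, f x ≤ g x) : sphereMean f ≤ sphereMean g := by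
  unfold sphereMean
  refine EReal.sub_le_sub ?_ ?_
  · exact EReal.coe_ennreal_le_coe_ennreal_iff.2
      (lintegral_mono fun x => EReal.toENNReal_le_toENNReal (h x))
  · exact EReal.coe_ennreal_le_coe_ennreal_iff.2
      (lintegral_mono fun x => EReal.toENNReal_le_toENNReal (EReal.neg_le_neg_iff.2 (h x)))

theorem sphereMean_coe {f : Metric.sphere (0 : EuclideanSpace ℝ (Fin d)) 1 → ℝ}
    (hf : Integrable f ((sphereMeasure d Set.univ)⁻¹ • sphereMeasure d)) :
    sphereMean (fun x => (f x : EReal)) =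
      ((∫ x, f x ∂((sphereMeasure d Set.univ)⁻¹ • sphereMeasure d) : ℝ) : EReal) := by
  unfold sphereMean
  rw [integral_eq_lintegral_pos_part_sub_lintegral_neg_part hf, laverage_eq', laverage_eq',
    EReal.coe_sub]
  have h1 := hf.lintegral_lt_top
  have h2 := hf.neg.lintegral_lt_top
  simp only [← EReal.coe_neg, EReal.toENNReal_of_ne_top (EReal.coe_ne_top _), EReal.toReal_coe]
  simp only [Pi.neg_apply] at h2
  rw [EReal.coe_ennreal_toReal h1.ne, EReal.coe_ennreal_toReal h2.ne]

theorem entropyAt_le_log [NeZero d] (hα : 0 < α) {D : ℝ} (hD : 1 ≤ D)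
    (hu : ∀ x : Metric.sphere (0 : EuclideanSpace ℝ (Fin d)) 1, supportFn Ω z x ≤ D) :
    entropyAt α Ω z ≤ (Real.log D : ℝ) := by
  have hD0 : 0 < D := by linarith
  unfold entropyAt
  split_ifs with h1
  · refine (sphereMean_mono (g := fun _ => ((Real.log D : ℝ) : EReal)) fun x => ?_).trans
      (le_of_eq ?_)
    · rw [← ENNReal.log_ofReal_of_pos hD0]
      exact ENNReal.log_le_log (ENNReal.ofReal_le_ofReal (hu x))
    · rw [sphereMean_coe (integrable_const _)]
      simp
  · set c := α / (α - 1) with hc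
    have hcs : c * (1 - 1 / α) = 1 := by
      rw [hc]; field_simp
    rcases lt_or_gt_of_ne h1 with hlt | hgt
    · have hs : 1 - 1 / α ≤ 0 := by
        rw [sub_nonpos, le_div_iff₀ hα]; linarith
      have hc0 : c ≤ 0 := div_nonpos_of_nonneg_of_nonpos hα.le (by linarith)
      have h2 : ENNReal.ofReal (D ^ (1 - 1 / α)) ≤
          ⨍⁻ x, ENNReal.ofReal (supportFn Ω z x) ^ (1 - 1 / α) ∂(sphereMeasure d) := by
        rw [← ENNReal.ofReal_rpow_of_pos hD0, ← laverage_const (sphereMeasure d) (_ ^ _)]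
        exact lintegral_mono fun x => ofReal_rpow_le_ofReal_rpow_of_nonpos (hu x) hs
      refine (EReal.coe_mul_le_coe_mul_of_nonpos hc0 (ENNReal.log_le_log h2)).trans (le_of_eq ?_)
      rw [log_ofReal_rpow hD0, ← EReal.coe_mul, ← mul_assoc, hcs, one_mul]
    · have hs : 0 ≤ 1 - 1 / α := by
        rw [sub_nonneg, div_le_iff₀ hα]; linarith
      have hc0 : 0 ≤ c := div_nonneg hα.le (by linarith)
      have h2 : ⨍⁻ x, ENNReal.ofReal (supportFn Ω z x) ^ (1 - 1 / α) ∂(sphereMeasure d) ≤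
          ENNReal.ofReal (D ^ (1 - 1 / α)) := by
        rw [← ENNReal.ofReal_rpow_of_pos hD0, ← laverage_const (sphereMeasure d) (_ ^ _)]
        exact lintegral_mono fun x =>
          ENNReal.rpow_le_rpow (ENNReal.ofReal_le_ofReal (hu x)) hs
      refine (mul_le_mul_of_nonneg_left (ENNReal.log_le_log h2)
        (by exact_mod_cast hc0)).trans (le_of_eq ?_)
      rw [log_ofReal_rpow hD0, ← EReal.coe_mul, ← mul_assoc, hcs, one_mul]

theorem entropyAt_le_of_le_laverage (hα : 0 < α) (hα1 : α < 1) {p K : ℝ} (hp : p = 1 / α - 1)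
    (hK : 0 < K)
    (hu : ENNReal.ofReal K ≤
      ⨍⁻ x, ENNReal.ofReal (supportFn Ω z x) ^ (-p) ∂(sphereMeasure d)) :
    entropyAt α Ω z ≤ ((-(1 / p) * Real.log K : ℝ) : EReal) := by
  have hc0 : α / (α - 1) ≤ 0 := div_nonpos_of_nonneg_of_nonpos hα.le (by linarith)
  have hcp : α / (α - 1) = -(1 / p) := by
    have : 1 - α ≠ 0 := by linarith
    have : α - 1 ≠ 0 := by linarith
    rw [hp]; field_simp; ring
  have hs : 1 - 1 / α = -p := by rw [hp]; ring
  rw [entropyAt, if_neg hα1.ne, hs]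
  refine (EReal.coe_mul_le_coe_mul_of_nonpos hc0 (ENNReal.log_le_log hu)).trans (le_of_eq ?_)
  rw [ENNReal.log_ofReal_of_pos hK, ← EReal.coe_mul, hcp]

/-- Monotonicity of power means, as `-p` is at most the order `1 - 1 / α` of the entropy. The
positive continuous minorant `H` keeps all integrals real and finite, although `supportFn` might
vanish. -/
theorem le_entropyAt_of_laverage_le [NeZero d] (hα : 0 < α) {p K : ℝ} (hp : 0 < p) (hps : -p ≤ 1 - 1 / α)
    (hK : 0 < K) {H : Metric.sphere (0 : EuclideanSpace ℝ (Fin d)) 1 → ℝ} (hH : Continuous H)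
    (hpos : ∀ x, 0 < H x) (hu : ∀ x, H x ≤ supportFn Ω z x)
    (hHK : ⨍⁻ x, ENNReal.ofReal (H x) ^ (-p) ∂(sphereMeasure d) ≤ ENNReal.ofReal K) :
    ((-(1 / p) * Real.log K : ℝ) : EReal) ≤ entropyAt α Ω z := by
  set M := K ^ (-(1 / p)) with hM
  have hM0 : 0 < M := Real.rpow_pos_of_pos hK _
  rw [laverage_eq', lintegral_ofReal_rpow _ hH hpos, ENNReal.ofReal_le_ofReal_iff hK.le] at hHK
  have hMp : M ^ (-p) = K := by
    rw [hM, ← Real.rpow_mul hK.le]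
    have : -(1 / p) * -p = 1 := by field_simp
    rw [this, Real.rpow_one]
  rw [← hMp] at hHK
  rw [← Real.log_rpow hK, ← hM]
  unfold entropyAt
  split_ifs with h1
  · refine le_trans ?_ (sphereMean_mono (f := fun x => ((Real.log (H x) : ℝ) : EReal))
      fun x => ?_)
    · rw [sphereMean_coe (integrable_log_of_continuous _ hH hpos)]
      exact_mod_cast log_le_integral_log _ hH hpos hp hM0 hHK
    · rw [← ENNReal.log_ofReal_of_pos (hpos x)]
      exact ENNReal.log_le_log (ENNReal.ofReal_le_ofReal (hu x))
  · set c := α / (α - 1) with hc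
    have hcs : c * (1 - 1 / α) = 1 := by
      rw [hc]; field_simp
    rcases lt_or_gt_of_ne h1 with hlt | hgt
    · have hs : 1 - 1 / α ≤ 0 := by
        rw [sub_nonpos, le_div_iff₀ hα]; linarith
      have hc0 : c ≤ 0 := div_nonpos_of_nonneg_of_nonpos hα.le (by linarith)
      have h2 : ⨍⁻ x, ENNReal.ofReal (supportFn Ω z x) ^ (1 - 1 / α) ∂(sphereMeasure d) ≤
          ENNReal.ofReal (M ^ (1 - 1 / α)) := by
        refine (lintegral_mono fun x =>
          ofReal_rpow_le_ofReal_rpow_of_nonpos (hu x) hs).trans ?_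
        rw [lintegral_ofReal_rpow _ hH hpos]
        exact ENNReal.ofReal_le_ofReal (integral_rpow_le_rpow _ hH hpos hp hM0 hHK hs hps)
      refine le_trans (le_of_eq ?_)
        (EReal.coe_mul_le_coe_mul_of_nonpos hc0 (ENNReal.log_le_log h2))
      rw [log_ofReal_rpow hM0, ← EReal.coe_mul, ← mul_assoc, hcs, one_mul]
    · have hs : 0 < 1 - 1 / α := by
        rw [sub_pos, div_lt_iff₀ hα]; linarith
      have hc0 : 0 ≤ c := div_nonneg hα.le (by linarith)
      have h2 : ENNReal.ofReal (M ^ (1 - 1 / α)) ≤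
          ⨍⁻ x, ENNReal.ofReal (supportFn Ω z x) ^ (1 - 1 / α) ∂(sphereMeasure d) := by
        refine le_trans ?_ (lintegral_mono fun x =>
          ENNReal.rpow_le_rpow (ENNReal.ofReal_le_ofReal (hu x)) hs.le)
        rw [lintegral_ofReal_rpow _ hH hpos]
        exact ENNReal.ofReal_le_ofReal (rpow_le_integral_rpow _ hH hpos hp hM0 hHK hs)
      refine le_trans (le_of_eq ?_) (mul_le_mul_of_nonneg_left (ENNReal.log_le_log h2)
        (by exact_mod_cast hc0))
      rw [log_ofReal_rpow hM0, ← EReal.coe_mul, ← mul_assoc, hcs, one_mul]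

end ConvexEntropy

/-! ### The box norm and its spherical means -/

noncomputable section
namespace ConvexEntropy

variable {d : ℕ} (b : OrthonormalBasis (Fin d) ℝ (EuclideanSpace ℝ (Fin d))) (a : Fin d → ℝ)

/-- The norm `max_i a_i |⟨b_i, x⟩|`. -/
def frameNorm (x : EuclideanSpace ℝ (Fin d)) : ℝ := ‖fun i => a i * inner ℝ (b i) x‖

theorem continuous_frameNorm : Continuous (frameNorm b a) := by
  unfold frameNorm; fun_prop

theorem frameNorm_smul {t : ℝ} (ht : 0 < t) (x : EuclideanSpace ℝ (Fin d)) :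
    frameNorm b a (t • x) = t * frameNorm b a x := by
  have : (fun i => a i * inner ℝ (b i) (t • x)) = t • fun i => a i * inner ℝ (b i) x := by
    funext i; simp [inner_smul_right]; ring
  rw [frameNorm, this, norm_smul, Real.norm_of_nonneg ht.le, frameNorm]

variable {a}

theorem frameNorm_le_iff (ha : ∀ i, 0 < a i) {c : ℝ} (hc : 0 ≤ c)
    {x : EuclideanSpace ℝ (Fin d)} :
    frameNorm b a x ≤ c ↔ ∀ i, a i * |inner ℝ (b i) x| ≤ c := by
  rw [frameNorm, pi_norm_le_iff_of_nonneg hc]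
  simp only [Real.norm_eq_abs, abs_mul, fun i => abs_of_pos (ha i)]

theorem le_frameNorm (ha : ∀ i, 0 < a i) (x : EuclideanSpace ℝ (Fin d)) (i : Fin d) :
    a i * |inner ℝ (b i) x| ≤ frameNorm b a x :=
  (frameNorm_le_iff b ha (norm_nonneg _)).1 le_rfl i

theorem frameNorm_pos (ha : ∀ i, 0 < a i) {x : EuclideanSpace ℝ (Fin d)} (hx : x ≠ 0) :
    0 < frameNorm b a x := by
  by_contra hcon
  have h := (frameNorm_le_iff b ha le_rfl).1 (not_lt.1 hcon)
  refine hx ?_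
  rw [← b.sum_repr' x]
  refine Finset.sum_eq_zero fun i _ => ?_
  have h1 : |inner ℝ (b i) x| ≤ 0 := by
    by_contra h2
    exact absurd (h i) (not_le.2 (mul_pos (ha i) (not_le.1 h2)))
  rw [abs_nonpos_iff.1 h1, zero_smul]

theorem sphere_ne_zero (x : Metric.sphere (0 : EuclideanSpace ℝ (Fin d)) 1) :
    (x : EuclideanSpace ℝ (Fin d)) ≠ 0 := by
  rw [← norm_ne_zero_iff]; simp

theorem setOf_frameNorm_le_one (ha : ∀ i, 0 < a i) :
    {y | frameNorm b a y ≤ 1} = {y | ∀ i, |inner ℝ (b i) y| ≤ (a i)⁻¹} := by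
  ext y
  rw [Set.mem_ofPred_eq, Set.mem_ofPred_eq, frameNorm_le_iff b ha zero_le_one]
  refine forall_congr' fun i => ?_
  rw [← one_div, le_div_iff₀ (ha i), mul_comm]

theorem nontrivial_of_neZero (d : ℕ) [NeZero d] : Nontrivial (EuclideanSpace ℝ (Fin d)) := by
  apply Module.nontrivial_of_finrank_pos (R := ℝ)
  simpa using Nat.pos_of_ne_zero (NeZero.ne d)

theorem lintegral_frameNorm [NeZero d] (ha : ∀ i, 0 < a i) {p : ℝ} (hp : 0 < p) :
    ∫⁻ x, ENNReal.ofReal (frameNorm b a x) ^ (-p) ∂(sphereMeasure d) =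
      ENNReal.ofReal p * ∫⁻ y in {y | ∀ i, |inner ℝ (b i) y| ≤ (a i)⁻¹},
        ENNReal.ofReal ‖y‖ ^ (p - d) := by
  have := nontrivial_of_neZero d
  rw [sphereMeasure, lintegral_sphere_rpow_neg volume _ (continuous_frameNorm b a).measurable
    (fun t ht x => frameNorm_smul b a ht x)
    (fun x hx => frameNorm_pos b ha (sphere_ne_zero ⟨x, hx⟩)) hp, setOf_frameNorm_le_one b ha]
  simp

theorem ofReal_mul_setLIntegral_box (ha : ∀ i, 0 < a i) (j : Fin d) {p : ℝ} (hp : 0 < p)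
    (hpd : (d : ℝ) - 1 < p) :
    ENNReal.ofReal p * ∫⁻ y in {y | ∀ i, |inner ℝ (b i) y| ≤ (a i)⁻¹},
      ENNReal.ofReal |inner ℝ (b j) y| ^ (p - d) =
    ENNReal.ofReal (p * 2 ^ d / (p - d + 1) * ((∏ i, a i)⁻¹ * a j ^ (d - p))) := by
  rw [setLIntegral_box b _ (fun i => inv_pos.2 (ha i)) j (by linarith), ← ENNReal.ofReal_mul hp.le,
    Finset.prod_inv_distrib, Real.inv_rpow (ha j).le, ← Real.rpow_neg (ha j).le, neg_sub]
  congr 1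
  ring

theorem measureReal_sphereMeasure_pos [NeZero d] : 0 < (sphereMeasure d).real Set.univ :=
  ENNReal.toReal_pos (NeZero.ne _ ∘ Measure.measure_univ_eq_zero.1) (measure_ne_top _ _)

theorem ofReal_div_sphereMeasure_univ [NeZero d] (t : ℝ) :
    ENNReal.ofReal t / sphereMeasure d Set.univ =
      ENNReal.ofReal (t / (sphereMeasure d).real Set.univ) := by
  rw [ENNReal.ofReal_div_of_pos measureReal_sphereMeasure_pos, Measure.real,
    ENNReal.ofReal_toReal (measure_ne_top _ _)]

/-- The constant in the estimates of the means of powers of `frameNorm`. -/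
def meanConst (d : ℕ) (p : ℝ) : ℝ :=
  p * 2 ^ d / (p - d + 1) / (sphereMeasure d).real Set.univ

theorem meanConst_pos [NeZero d] {p : ℝ} (hp : 0 < p) (hpd : (d : ℝ) - 1 < p) :
    0 < meanConst d p :=
  div_pos (div_pos (by positivity) (by linarith)) measureReal_sphereMeasure_pos

/-- The exponent `p - d` is nonpositive, so replacing `‖y‖` by the smaller `|⟨b j, y⟩|` increases
the integrand; `p > d - 1` keeps it integrable. -/
theorem laverage_frameNorm_le [NeZero d] (ha : ∀ i, 0 < a i) (j : Fin d) {p : ℝ} (hp : 0 < p)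
    (hpd : (d : ℝ) - 1 < p) (hpd' : p ≤ d) :
    ⨍⁻ x, ENNReal.ofReal (frameNorm b a x) ^ (-p) ∂(sphereMeasure d) ≤
      ENNReal.ofReal (meanConst d p * ((∏ i, a i)⁻¹ * a j ^ (d - p))) := by
  rw [laverage_eq, lintegral_frameNorm b ha hp, meanConst, div_mul_eq_mul_div,
    ← ofReal_div_sphereMeasure_univ, ← ofReal_mul_setLIntegral_box b ha j hp hpd]
  refine ENNReal.div_le_div_right (mul_le_mul_right (lintegral_mono fun y => ?_) _) _
  refine ofReal_rpow_le_ofReal_rpow_of_nonpos ?_ (by linarith)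
  exact (abs_real_inner_le_norm _ _).trans (by simp)

theorem le_laverage_frameNorm [NeZero d] (ha : ∀ i, 0 < a i) (j : Fin d) {p : ℝ} (hp : 0 < p)
    (hpd : (d : ℝ) ≤ p) :
    ENNReal.ofReal (meanConst d p * ((∏ i, a i)⁻¹ * a j ^ (d - p))) ≤
      ⨍⁻ x, ENNReal.ofReal (frameNorm b a x) ^ (-p) ∂(sphereMeasure d) := by
  rw [laverage_eq, lintegral_frameNorm b ha hp, meanConst, div_mul_eq_mul_div,
    ← ofReal_div_sphereMeasure_univ, ← ofReal_mul_setLIntegral_box b ha j hp (by linarith)]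
  refine ENNReal.div_le_div_right (mul_le_mul_right (lintegral_mono fun y => ?_) _) _
  refine ENNReal.rpow_le_rpow (ENNReal.ofReal_le_ofReal ?_) (by linarith)
  exact (abs_real_inner_le_norm _ _).trans (by simp)

end ConvexEntropy
end

/-! ### Geometry of bodies with the volume of the unit ball -/

noncomputable section
namespace ConvexEntropy

variable {d : ℕ} {Ω : ConvexBody (EuclideanSpace ℝ (Fin d))}

theorem le_supportFn {z w x : EuclideanSpace ℝ (Fin d)} (hw : w ∈ Ω) :
    inner ℝ (w - z) x ≤ supportFn Ω z x :=
  le_csSup (Ω.isCompact.image (by fun_prop)).bddAbove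
    (Set.mem_image_of_mem (fun w => inner ℝ (w - z) x) hw)

theorem supportFn_le {z x : EuclideanSpace ℝ (Fin d)} {D : ℝ}
    (h : ∀ w ∈ Ω, inner ℝ (w - z) x ≤ D) : supportFn Ω z x ≤ D := by
  refine csSup_le (Ω.nonempty.image _) ?_
  rintro _ ⟨w, hw, rfl⟩
  exact h w hw

theorem exists_entropy_eq {α lo hi : ℝ} {z : EuclideanSpace ℝ (Fin d)} (hz : z ∈ Ω)
    (hlo : (lo : EReal) ≤ entropyAt α Ω z) (hhi : ∀ w ∈ Ω, entropyAt α Ω w ≤ (hi : EReal)) :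
    ∃ E : ℝ, entropy α Ω = (E : EReal) ∧ lo ≤ E ∧ E ≤ hi := by
  have h1 : (lo : EReal) ≤ entropy α Ω :=
    hlo.trans (le_iSup₂ (f := fun w (_ : w ∈ Ω) => entropyAt α Ω w) z hz)
  have h2 : entropy α Ω ≤ (hi : EReal) := iSup₂_le hhi
  have h3 : ((entropy α Ω).toReal : EReal) = entropy α Ω :=
    EReal.coe_toReal (ne_top_of_le_ne_top (EReal.coe_ne_top _) h2)
      (ne_bot_of_le_ne_bot (EReal.coe_ne_bot _) h1)
  refine ⟨_, h3.symm, ?_, ?_⟩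
  · rw [← h3] at h1; exact_mod_cast h1
  · rw [← h3] at h2; exact_mod_cast h2

/-- The ratio between the outer and the inner box in `exists_box_frame`. -/
def boxRatio (d : ℕ) : ℝ := 5 ^ d * d

theorem boxRatio_pos [NeZero d] : 0 < boxRatio d := by
  have : (0 : ℝ) < d := by exact_mod_cast Nat.pos_of_ne_zero (NeZero.ne d)
  unfold boxRatio; positivity

/-- The product of the half-axes of a box with the volume of the unit ball. -/
def boxConst (d : ℕ) : ℝ :=
  volume.real (Metric.ball (0 : EuclideanSpace ℝ (Fin d)) 1) / 2 ^ d

theorem boxConst_pos : 0 < boxConst d :=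
  div_pos (ENNReal.toReal_pos (Metric.measure_ball_pos _ _ one_pos).ne' measure_ball_lt_top.ne)
    (by positivity)

/-- A box with axes `b` and half-axes `a` around `z` is contained in `Ω`, and its dilation by
`boxRatio d` contains `Ω`. -/
structure IsBoxFrame (Ω : ConvexBody (EuclideanSpace ℝ (Fin d)))
    (b : OrthonormalBasis (Fin d) ℝ (EuclideanSpace ℝ (Fin d))) (a : Fin d → ℝ)
    (z : EuclideanSpace ℝ (Fin d)) : Prop where
  pos : ∀ i, 0 < a i
  box_subset : ∀ y, (∀ i, |inner ℝ (b i) (y - z)| ≤ a i) → y ∈ Ω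
  subset_box : ∀ y ∈ Ω, ∀ i, |inner ℝ (b i) (y - z)| ≤ boxRatio d * a i
  prod_le : ∏ i, a i ≤ boxConst d
  inv_prod_le : (∏ i, a i)⁻¹ ≤ boxRatio d ^ d / boxConst d

/-- Comparing volumes of the inner box, `Ω` and the outer box traps `∏ a i` between `boxConst d /
boxRatio d ^ d` and `boxConst d`; in particular no half-axis vanishes. -/
theorem exists_isBoxFrame [NeZero d]
    (hΩ : volume (Ω : Set (EuclideanSpace ℝ (Fin d))) =
      volume (Metric.ball (0 : EuclideanSpace ℝ (Fin d)) 1)) :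
    ∃ b a z, IsBoxFrame Ω b a z := by
  obtain ⟨b, a, z, -, ha, hin, hout⟩ :=
    exists_box_frame (Ω : Set (EuclideanSpace ℝ (Fin d))) Ω.isCompact Ω.convex Ω.nonempty
  have hA := boxRatio_pos (d := d)
  have hκ := boxConst_pos (d := d)
  have h2 : (0 : ℝ) < 2 ^ d := by positivity
  have hV : volume (Metric.ball (0 : EuclideanSpace ℝ (Fin d)) 1) =
      ENNReal.ofReal (2 ^ d * boxConst d) := by
    rw [boxConst, mul_div_cancel₀ _ h2.ne', Measure.real, ENNReal.ofReal_toReal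
      measure_ball_lt_top.ne]
  have hprod : 0 ≤ ∏ i, a i := Finset.prod_nonneg fun i _ => ha i
  have h3 : ∏ i, a i ≤ boxConst d := by
    have : volume {y | ∀ i, |inner ℝ (b i) (y - z)| ≤ a i} ≤
        volume (Ω : Set (EuclideanSpace ℝ (Fin d))) := measure_mono fun y hy => hin y hy
    rw [volume_box b z a ha, hΩ, hV, ENNReal.ofReal_le_ofReal_iff (by positivity)] at this
    exact le_of_mul_le_mul_left this h2
  have h4 : boxConst d ≤ boxRatio d ^ d * ∏ i, a i := by
    have : volume (Ω : Set (EuclideanSpace ℝ (Fin d))) ≤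
        volume {y | ∀ i, |inner ℝ (b i) (y - z)| ≤ boxRatio d * a i} :=
      measure_mono fun y hy => hout y hy
    rw [volume_box b z _ (fun i => mul_nonneg hA.le (ha i)), hΩ, hV,
      Finset.prod_mul_distrib, Finset.prod_const, Finset.card_univ, Fintype.card_fin,
      ENNReal.ofReal_le_ofReal_iff (by positivity)] at this
    exact le_of_mul_le_mul_left this h2
  have h5 : 0 < ∏ i, a i := by
    rcases hprod.eq_or_lt with h | h
    · rw [← h, mul_zero] at h4; linarith
    · exact h
  refine ⟨b, a, z, fun i => (ha i).lt_of_ne' fun h => ?_, hin, hout, h3, ?_⟩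
  · exact h5.ne' (Finset.prod_eq_zero (Finset.mem_univ i) h)
  · rw [le_div_iff₀ hκ, inv_mul_le_iff₀ h5, mul_comm]; exact h4

namespace IsBoxFrame

variable {b : OrthonormalBasis (Fin d) ℝ (EuclideanSpace ℝ (Fin d))} {a : Fin d → ℝ}
  {z : EuclideanSpace ℝ (Fin d)}

theorem center_mem (h : IsBoxFrame Ω b a z) : z ∈ Ω :=
  h.box_subset z fun i => by simpa using (h.pos i).le

theorem closedBall_subset (h : IsBoxFrame Ω b a z) {r : ℝ} (hr : ∀ i, r ≤ a i) :
    Metric.closedBall z r ⊆ (Ω : Set (EuclideanSpace ℝ (Fin d))) := by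
  intro y hy
  refine h.box_subset y fun i => (abs_real_inner_le_norm _ _).trans ?_
  rw [b.norm_eq_one, one_mul, ← dist_eq_norm]
  exact (Metric.mem_closedBall.1 hy).trans (hr i)

theorem subset_closedBall (h : IsBoxFrame Ω b a z) {r : ℝ} (hr : ∀ i, boxRatio d * a i ≤ r) :
    (Ω : Set (EuclideanSpace ℝ (Fin d))) ⊆ Metric.closedBall z (d * r) := by
  intro y hy
  rw [Metric.mem_closedBall, dist_eq_norm, ← b.sum_repr' (y - z)]
  refine (norm_sum_le _ _).trans ?_
  refine (Finset.sum_le_card_nsmul _ _ r fun i _ => ?_).trans (by simp)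
  rw [norm_smul, b.norm_eq_one, mul_one]
  exact (h.subset_box y hy i).trans (hr i)

theorem frameNorm_le_supportFn (h : IsBoxFrame Ω b a z) (x : EuclideanSpace ℝ (Fin d)) :
    frameNorm b a x ≤ supportFn Ω z x := by
  have h0 : 0 ≤ supportFn Ω z x := by
    simpa using le_supportFn (z := z) (x := x) h.center_mem
  rw [frameNorm_le_iff b h.pos h0]
  intro i
  have hmem : ∀ t : ℝ, |t| ≤ a i → z + t • b i ∈ Ω := fun t ht => by
    refine h.box_subset _ fun k => ?_
    rw [add_sub_cancel_left, inner_smul_right, b.inner_eq_ite]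
    split_ifs with hk
    · subst hk; simpa using ht
    · simpa using (h.pos k).le
  have h1 := le_supportFn (z := z) (x := x) (hmem (a i) (abs_of_pos (h.pos i)).le)
  have h2 := le_supportFn (z := z) (x := x)
    (hmem (-a i) (by rw [abs_neg]; exact (abs_of_pos (h.pos i)).le))
  rw [add_sub_cancel_left, real_inner_smul_left] at h1 h2
  rw [← abs_of_pos (h.pos i), ← abs_mul, abs_le]
  constructor <;> linarith

theorem supportFn_le_frameNorm [NeZero d] (h : IsBoxFrame Ω b a z)
    {w : EuclideanSpace ℝ (Fin d)} (hw : w ∈ Ω) (x : EuclideanSpace ℝ (Fin d)) :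
    supportFn Ω w x ≤ frameNorm b (fun i => 2 * boxRatio d * d * a i) x := by
  have hd : (0 : ℝ) < d := by exact_mod_cast Nat.pos_of_ne_zero (NeZero.ne d)
  have hA := boxRatio_pos (d := d)
  have hpos : ∀ i, 0 < 2 * boxRatio d * d * a i := fun i => by have := h.pos i; positivity
  refine supportFn_le fun y hy => ?_
  rw [← b.sum_inner_mul_inner]
  set N := frameNorm b (fun i => 2 * boxRatio d * d * a i) x with hN
  refine (Finset.sum_le_card_nsmul _ _ (N / d) fun i _ => ?_).trans (by
    simp [mul_div_cancel₀ _ hd.ne'])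
  -- Both points lie in the outer box, hence the factor 2; the factor `d` in the norm absorbs the
  -- sum over coordinates.
  have h1 : |inner ℝ (y - w) (b i)| ≤ 2 * boxRatio d * a i := by
    have e : inner ℝ (y - w) (b i) = inner ℝ (b i) (y - z) - inner ℝ (b i) (w - z) := by
      rw [real_inner_comm, ← inner_sub_right]; congr 1; abel
    rw [e]
    refine (abs_sub _ _).trans ?_
    linarith [h.subset_box y hy i, h.subset_box w hw i]
  have h2 := le_frameNorm b hpos x i
  rw [← hN] at h2
  refine (le_abs_self _).trans ?_
  rw [abs_mul, le_div_iff₀ hd]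
  refine le_trans ?_ h2
  calc _ ≤ 2 * boxRatio d * a i * |inner ℝ (b i) x| * d := by gcongr
    _ = _ := by ring

theorem le_inv_pow (h : IsBoxFrame Ω b a z) {j : Fin d} (hj : ∀ i, a j ≤ a i) (k : Fin d) :
    a k ≤ boxConst d * (a j ^ (d - 1))⁻¹ := by
  rw [← div_eq_mul_inv, le_div_iff₀ (pow_pos (h.pos j) _)]
  refine le_trans ?_ h.prod_le
  rw [← Finset.mul_prod_erase _ _ (Finset.mem_univ k)]
  refine mul_le_mul_of_nonneg_left ?_ (h.pos k).le
  have := Finset.prod_le_prod (s := Finset.univ.erase k) (f := fun _ => a j) (g := a)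
    (fun i _ => (h.pos j).le) (fun i _ => hj i)
  simpa using this

end IsBoxFrame

/-- Needed for the supremum to be meaningful: a ball of radius above 1 has too much volume. -/
theorem bddAbove_innerRadius [NeZero d]
    (hΩ : volume (Ω : Set (EuclideanSpace ℝ (Fin d))) =
      volume (Metric.ball (0 : EuclideanSpace ℝ (Fin d)) 1)) :
    BddAbove {r : ℝ | 0 ≤ r ∧ ∃ c : EuclideanSpace ℝ (Fin d), Metric.closedBall c r ⊆ Ω} := by
  refine ⟨1, ?_⟩
  rintro r ⟨hr, c, hc⟩
  have h1 := measure_mono (μ := volume) hc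
  rw [hΩ, Measure.addHaar_closedBall _ _ hr] at h1
  by_contra hcon
  have h2 : 1 < r ^ Module.finrank ℝ (EuclideanSpace ℝ (Fin d)) :=
    one_lt_pow₀ (not_le.1 hcon) (by simpa using NeZero.ne d)
  have h3 : (1 : ENNReal) < ENNReal.ofReal
      (r ^ Module.finrank ℝ (EuclideanSpace ℝ (Fin d))) := by
    rwa [← ENNReal.ofReal_one, ENNReal.ofReal_lt_ofReal_iff (by linarith)]
  have h4 := ENNReal.mul_lt_mul_right (a := volume (Metric.ball (0 : EuclideanSpace ℝ (Fin d)) 1))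
    (Metric.measure_ball_pos _ _ one_pos).ne' measure_ball_lt_top.ne h3
  rw [mul_one, mul_comm] at h4
  exact absurd h1 (not_le.2 h4)

theorem le_innerRadius [NeZero d]
    (hΩ : volume (Ω : Set (EuclideanSpace ℝ (Fin d))) =
      volume (Metric.ball (0 : EuclideanSpace ℝ (Fin d)) 1))
    {r : ℝ} (hr : 0 ≤ r) {c : EuclideanSpace ℝ (Fin d)} (hc : Metric.closedBall c r ⊆ Ω) :
    r ≤ innerRadius Ω :=
  le_csSup (bddAbove_innerRadius hΩ) ⟨hr, c, hc⟩

theorem exists_closedBall_subset (h : 0 < innerRadius Ω) :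
    ∃ r c, innerRadius Ω / 2 < r ∧ Metric.closedBall c r ⊆
      (Ω : Set (EuclideanSpace ℝ (Fin d))) := by
  obtain ⟨z, hz⟩ := Ω.nonempty
  obtain ⟨r, ⟨-, c, hc⟩, hlt⟩ := exists_lt_of_lt_csSup
    (s := {r : ℝ | 0 ≤ r ∧ ∃ c : EuclideanSpace ℝ (Fin d), Metric.closedBall c r ⊆ Ω})
    ⟨0, le_rfl, z, by simpa using hz⟩ (half_lt_self h)
  exact ⟨r, c, hlt, hc⟩

theorem le_minWidth [NeZero d] {r : ℝ} (hr : 0 ≤ r) {c : EuclideanSpace ℝ (Fin d)}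
    (hc : Metric.closedBall c r ⊆ (Ω : Set (EuclideanSpace ℝ (Fin d)))) :
    r ≤ minWidth Ω := by
  have := nontrivial_of_neZero d
  refine le_csInf ((NormedSpace.sphere_nonempty.2 zero_le_one).image _) ?_
  rintro _ ⟨x, hx, rfl⟩
  have hx1 : ‖x‖ = 1 := by simpa using hx
  have hxx : inner ℝ x x = (1 : ℝ) := by rw [real_inner_self_eq_norm_sq, hx1]; norm_num
  have hmem : ∀ t : ℝ, |t| ≤ r → c + t • x ∈ Ω := fun t ht => hc (by
    rw [Metric.mem_closedBall, dist_eq_norm, add_sub_cancel_left, norm_smul, hx1, mul_one]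
    exact ht)
  have h1 := le_supportFn (z := 0) (x := x) (hmem r (abs_of_nonneg hr).le)
  have h2 := le_supportFn (z := 0) (x := -x)
    (hmem (-r) (by rw [abs_neg]; exact (abs_of_nonneg hr).le))
  simp only [sub_zero, inner_add_left, inner_neg_right, real_inner_smul_left, hxx] at h1 h2
  rw [width]
  linarith

theorem maxWidth_le [NeZero d] {r : ℝ} {c : EuclideanSpace ℝ (Fin d)}
    (hc : (Ω : Set (EuclideanSpace ℝ (Fin d))) ⊆ Metric.closedBall c r) :
    maxWidth Ω ≤ 2 * r := by
  have := nontrivial_of_neZero d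
  refine csSup_le ((NormedSpace.sphere_nonempty.2 zero_le_one).image _) ?_
  rintro _ ⟨x, hx, rfl⟩
  have hx1 : ‖x‖ = 1 := by simpa using hx
  have key : ∀ v : EuclideanSpace ℝ (Fin d), ‖v‖ = 1 →
      supportFn Ω 0 v ≤ inner ℝ c v + r := fun v hv => supportFn_le fun w hw => by
    have h1 := real_inner_le_norm (w - c) v
    have h2 := Metric.mem_closedBall.1 (hc hw)
    rw [dist_eq_norm] at h2
    rw [hv, mul_one, inner_sub_left] at h1
    rw [sub_zero]
    linarith
  have h1 := key x hx1
  have h2 := key (-x) (by rwa [norm_neg])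
  rw [inner_neg_right] at h2
  rw [width]
  linarith

theorem outerRadius_le {r : ℝ} (hr : 0 ≤ r) {c : EuclideanSpace ℝ (Fin d)}
    (hc : (Ω : Set (EuclideanSpace ℝ (Fin d))) ⊆ Metric.closedBall c r) :
    outerRadius Ω ≤ r :=
  csInf_le ⟨0, fun _ h => h.1⟩ ⟨hr, c, hc⟩

end ConvexEntropy
end

/-! ### The two entropy estimates -/

namespace ConvexEntropy

variable {d : ℕ} [NeZero d] {Ω : ConvexBody (EuclideanSpace ℝ (Fin d))}

theorem exists_min_index (a : Fin d → ℝ) : ∃ j, ∀ i, a j ≤ a i := by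
  have : Nonempty (Fin d) := ⟨⟨0, Nat.pos_of_ne_zero (NeZero.ne d)⟩⟩
  exact Finite.exists_min a

theorem entropy_bounds_of_supercritical {α : ℝ} (hα : 1 / ((d : ℝ) + 1) < α) :
    ∃ β C : ℝ, 0 < β ∧ 0 < C ∧ ∀ Ω : ConvexBody (EuclideanSpace ℝ (Fin d)),
      volume (Ω : Set (EuclideanSpace ℝ (Fin d))) =
        volume (Metric.ball (0 : EuclideanSpace ℝ (Fin d)) 1) →
      ∃ E : ℝ, entropy α Ω = (E : EReal) ∧
        C⁻¹ * Real.exp (-β * E) ≤ min (innerRadius Ω) (minWidth Ω) ∧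
        max (maxWidth Ω) (outerRadius Ω) ≤ C * Real.exp (((d - 1 : ℕ) : ℝ) * β * E) := by
  have hd : (1 : ℝ) ≤ d := by exact_mod_cast Nat.pos_of_ne_zero (NeZero.ne d)
  have hα0 : 0 < α := lt_trans (by positivity) hα
  have hαd : 1 / α - 1 < d := by
    rw [div_lt_iff₀ (by positivity)] at hα
    rw [sub_lt_iff_lt_add, div_lt_iff₀ hα0]; linarith
  -- The first entry ensures `p > d - 1`, for integrability; the second ensures `-p ≤ 1 - 1 / α`,
  -- for power mean monotonicity.
  set p := max ((d : ℝ) - 1 / 2) (1 / α - 1) with hpdef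
  have hp1 : (d : ℝ) - 1 < p := lt_of_lt_of_le (by linarith) (le_max_left _ _)
  have hp2 : p < d := max_lt (by linarith) hαd
  have hp0 : 0 < p := by linarith
  have hps : -p ≤ 1 - 1 / α := by
    have := le_max_right ((d : ℝ) - 1 / 2) (1 / α - 1)
    linarith
  have hdp : 0 < d - p := by linarith
  have hA := boxRatio_pos (d := d)
  have hκ := boxConst_pos (d := d)
  have hm := meanConst_pos hp0 hp1
  set M := meanConst d p * (boxRatio d ^ d / boxConst d) with hM
  have hM0 : 0 < M := by positivity
  set T := Real.exp (Real.log M / (d - p)) with hT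
  have hT0 : 0 < T := Real.exp_pos _
  set R := 2 * (d * (boxRatio d * boxConst d)) * T ^ (d - 1) with hR
  have hR0 : 0 < R := by positivity
  refine ⟨p / (d - p), T + R, by positivity, by positivity, fun Ω hΩ => ?_⟩
  obtain ⟨b, a, z, h⟩ := exists_isBoxFrame hΩ
  obtain ⟨j, hj⟩ := exists_min_index a
  have haj := h.pos j
  have hz := h.center_mem
  have hout := h.subset_closedBall (r := boxRatio d * (boxConst d * (a j ^ (d - 1))⁻¹))
    fun i => mul_le_mul_of_nonneg_left (h.le_inv_pow hj i) hA.le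
  set ρ := d * (boxRatio d * (boxConst d * (a j ^ (d - 1))⁻¹)) with hρ
  have hρ0 : 0 < ρ := by positivity
  have hmean : ⨍⁻ x, ENNReal.ofReal (frameNorm b a x) ^ (-p) ∂(sphereMeasure d) ≤
      ENNReal.ofReal (M * a j ^ (d - p)) := by
    refine (laverage_frameNorm_le b h.pos j hp0 hp1 hp2.le).trans
      (ENNReal.ofReal_le_ofReal ?_)
    rw [hM, mul_assoc]
    have := h.inv_prod_le
    gcongr
  have hlo := le_entropyAt_of_laverage_le (Ω := Ω) (z := z) hα0 hp0 hps
    (by positivity) ((continuous_frameNorm b a).comp continuous_subtype_val)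
    (fun x => frameNorm_pos b h.pos (sphere_ne_zero x))
    (fun x => h.frameNorm_le_supportFn x) hmean
  -- A crude diameter bound, used only for finiteness of the entropy.
  have hhi : ∀ w ∈ Ω, entropyAt α Ω w ≤ ((Real.log (max 1 (2 * ρ)) : ℝ) : EReal) := fun w hw => by
    refine entropyAt_le_log hα0 (le_max_left _ _) fun x => (supportFn_le fun y hy => ?_).trans
      (le_max_right _ _)
    refine (real_inner_le_norm _ _).trans ?_
    have hx1 : ‖(x : EuclideanSpace ℝ (Fin d))‖ = 1 := by simp
    rw [hx1, mul_one, ← dist_eq_norm]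
    have h1 := Metric.mem_closedBall.1 (hout hy)
    have h2 := Metric.mem_closedBall.1 (hout hw)
    linarith [dist_triangle_right y w z]
  obtain ⟨E, hE, hElo, -⟩ := exists_entropy_eq hz hlo hhi
  have hexp : Real.exp (-(p / (d - p)) * E) ≤ T * a j := by
    rw [hT, ← Real.exp_log haj, ← Real.exp_add, Real.exp_le_exp]
    rw [Real.log_mul hM0.ne' (Real.rpow_pos_of_pos haj _).ne', Real.log_rpow haj] at hElo
    have h1 := mul_le_mul_of_nonneg_left hElo (div_pos hp0 hdp).le
    have h2 : p / (d - p) * (-(1 / p) * (Real.log M + (d - p) * Real.log (a j))) =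
        -(Real.log M / (d - p) + Real.log (a j)) := by
      field_simp
    linarith
  refine ⟨E, hE, ?_, ?_⟩
  · have h1 : (T + R)⁻¹ * Real.exp (-(p / (d - p)) * E) ≤ a j := by
      rw [inv_mul_le_iff₀ (by positivity)]
      refine hexp.trans (mul_le_mul_of_nonneg_right (by linarith) haj.le)
    have hball := h.closedBall_subset hj
    exact le_min (h1.trans (le_innerRadius hΩ haj.le hball))
      (h1.trans (le_minWidth haj.le hball))
  · have h1 : (a j ^ (d - 1))⁻¹ ≤
        T ^ (d - 1) * Real.exp (((d - 1 : ℕ) : ℝ) * (p / (d - p)) * E) := by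
      have h2 : Real.exp (-(p / (d - p)) * E) ^ (d - 1) ≤ T ^ (d - 1) * a j ^ (d - 1) := by
        rw [← mul_pow]; gcongr
      have h3 : Real.exp (((d - 1 : ℕ) : ℝ) * (p / (d - p)) * E) =
          (Real.exp (-(p / (d - p)) * E) ^ (d - 1))⁻¹ := by
        rw [← Real.exp_nat_mul, ← Real.exp_neg]; congr 1; ring
      rw [h3, ← div_eq_mul_inv, le_div_iff₀ (by positivity), inv_mul_le_iff₀ (by positivity),
        mul_comm (a j ^ (d - 1))]
      exact h2
    have h4 : 2 * ρ ≤ (T + R) * Real.exp (((d - 1 : ℕ) : ℝ) * (p / (d - p)) * E) := by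
      calc 2 * ρ = 2 * (d * (boxRatio d * boxConst d)) * (a j ^ (d - 1))⁻¹ := by rw [hρ]; ring
        _ ≤ 2 * (d * (boxRatio d * boxConst d)) *
            (T ^ (d - 1) * Real.exp (((d - 1 : ℕ) : ℝ) * (p / (d - p)) * E)) := by gcongr
        _ = R * Real.exp (((d - 1 : ℕ) : ℝ) * (p / (d - p)) * E) := by rw [hR]; ring
        _ ≤ _ := by gcongr; linarith
    exact max_le ((maxWidth_le hout).trans h4)
      ((outerRadius_le hρ0.le hout).trans (le_trans (by linarith) h4))

theorem entropy_bounds_of_subcritical {α : ℝ} (hα0 : 0 < α) (hα : α < 1 / ((d : ℝ) + 1)) :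
    ∃ C : ℝ, 0 < C ∧ ∀ Ω : ConvexBody (EuclideanSpace ℝ (Fin d)),
      volume (Ω : Set (EuclideanSpace ℝ (Fin d))) =
        volume (Metric.ball (0 : EuclideanSpace ℝ (Fin d)) 1) →
      ∃ E : ℝ, entropy α Ω = (E : EReal) ∧
        |E - (1 - α * ((d : ℝ) + 1)) / (1 - α) * Real.log (innerRadius Ω)| ≤ C := by
  have hd : (1 : ℝ) ≤ d := by exact_mod_cast Nat.pos_of_ne_zero (NeZero.ne d)
  have hαd : α * (d + 1) < 1 := by rwa [lt_div_iff₀ (by positivity)] at hα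
  have hα1 : α < 1 := by nlinarith
  obtain ⟨p, hp⟩ : ∃ p, p = 1 / α - 1 := ⟨_, rfl⟩
  have hpd : (d : ℝ) < p := by
    rw [hp, lt_sub_iff_add_lt, lt_div_iff₀ hα0]; linarith
  have hp0 : 0 < p := by linarith
  have hγ : (1 - α * ((d : ℝ) + 1)) / (1 - α) = -(1 / p) * (d - p) := by
    have : 1 - α ≠ 0 := by linarith
    rw [hp]; field_simp; ring
  have hA := boxRatio_pos (d := d)
  have hκ := boxConst_pos (d := d)
  have hm := meanConst_pos hp0 (show (d : ℝ) - 1 < p by linarith)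
  have hm' := meanConst_pos (d := d) (p := d) (by linarith) (by linarith)
  set B := 2 * boxRatio d * d with hB
  have hB0 : 0 < B := by positivity
  set M₁ := meanConst d p * ((B ^ d)⁻¹ * (boxConst d)⁻¹ * B ^ ((d : ℝ) - p)) with hM₁
  have hM₁0 : 0 < M₁ := by positivity
  set M₂ := (1 / 4) ^ ((d : ℝ) - p) *
    (meanConst d d * (((1 / 2) ^ d)⁻¹ * (boxRatio d ^ d / boxConst d))) with hM₂
  have hM₂0 : 0 < M₂ := by positivity
  refine ⟨1 / p * |Real.log M₁| + 1 / p * |Real.log M₂| + 1, by positivity, fun Ω hΩ => ?_⟩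
  obtain ⟨b, a, z, h⟩ := exists_isBoxFrame hΩ
  obtain ⟨j, hj⟩ := exists_min_index a
  have haj := h.pos j
  have hz := h.center_mem
  have hprod : 0 < ∏ i, a i := Finset.prod_pos fun i _ => h.pos i
  have hρj : a j ≤ innerRadius Ω := le_innerRadius hΩ haj.le (h.closedBall_subset hj)
  have hρ : 0 < innerRadius Ω := haj.trans_le hρj
  set ρ := innerRadius Ω with hρdef
  have hhi : ∀ w ∈ Ω, entropyAt α Ω w ≤
      ((-(1 / p) * Real.log (M₁ * ρ ^ ((d : ℝ) - p)) : ℝ) : EReal) := fun w hw => by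
    refine entropyAt_le_of_le_laverage hα0 hα1 hp (by positivity) ?_
    have hpos : ∀ i, 0 < B * a i := fun i => mul_pos hB0 (h.pos i)
    refine le_trans ?_ ((le_laverage_frameNorm b hpos j hp0 hpd.le).trans
      (lintegral_mono fun x => ofReal_rpow_le_ofReal_rpow_of_nonpos
        (h.supportFn_le_frameNorm hw x) (by linarith)))
    refine ENNReal.ofReal_le_ofReal ?_
    rw [Finset.prod_mul_distrib, Finset.prod_const, Finset.card_univ, Fintype.card_fin,
      mul_inv, Real.mul_rpow hB0.le haj.le]
    -- The exponent `d - p` is negative, so `a j ≤ ρ` suffices; no reverse comparison is needed.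
    have h1 : ρ ^ ((d : ℝ) - p) ≤ a j ^ ((d : ℝ) - p) :=
      Real.rpow_le_rpow_of_nonpos haj hρj (by linarith)
    have h2 : (boxConst d)⁻¹ ≤ (∏ i, a i)⁻¹ := inv_anti₀ hprod h.prod_le
    calc M₁ * ρ ^ ((d : ℝ) - p) = meanConst d p * ((B ^ d)⁻¹ * (boxConst d)⁻¹ *
          (B ^ ((d : ℝ) - p) * ρ ^ ((d : ℝ) - p))) := by rw [hM₁]; ring
      _ ≤ _ := by gcongr
  obtain ⟨r, c, hr, hc⟩ := exists_closedBall_subset hρ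
  rw [← hρdef] at hr
  have hr0 : 0 < r := by linarith
  have hcΩ : c ∈ Ω := hc (Metric.mem_closedBall_self hr0.le)
  -- Seen from the midpoint, `Ω` contains half of `Ω - z` and half of the ball around `c`, so both
  -- lower bounds on the support function survive up to a factor 2.
  set z' : EuclideanSpace ℝ (Fin d) := (1 / 2 : ℝ) • z + (1 / 2 : ℝ) • c with hz'
  have hmid : ∀ v ∈ Ω, ∀ w ∈ Ω, (1 / 2 : ℝ) • v + (1 / 2 : ℝ) • w ∈ Ω := fun v hv w hw =>
    Ω.convex hv hw (by norm_num) (by norm_num) (by norm_num)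
  have hhalf : ∀ i, 0 < 1 / 2 * a i := fun i => by have := h.pos i; positivity
  set H : EuclideanSpace ℝ (Fin d) → ℝ := fun x =>
    max (frameNorm b (fun i => 1 / 2 * a i) x) (ρ / 4) with hH
  have hHle : ∀ x : Metric.sphere (0 : EuclideanSpace ℝ (Fin d)) 1,
      H x ≤ supportFn Ω z' x := fun x => by
    refine max_le ?_ ?_
    · have h1 : frameNorm b (fun i => 1 / 2 * a i) x = 1 / 2 * frameNorm b a x := by
        have : (fun i => 1 / 2 * a i * inner ℝ (b i) (x : EuclideanSpace ℝ (Fin d))) =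
            (1 / 2 : ℝ) • fun i => a i * inner ℝ (b i) (x : EuclideanSpace ℝ (Fin d)) := by
          funext i; simp [mul_assoc]
        rw [frameNorm, this, norm_smul, frameNorm]; norm_num
      have h2 : supportFn Ω z x ≤ 2 * supportFn Ω z' x := supportFn_le fun w hw => by
        have := le_supportFn (z := z') (x := (x : EuclideanSpace ℝ (Fin d))) (hmid w hw c hcΩ)
        have e : (1 / 2 : ℝ) • w + (1 / 2 : ℝ) • c - z' = (1 / 2 : ℝ) • (w - z) := by
          rw [hz']; module
        rw [e, real_inner_smul_left] at this
        linarith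
      linarith [h.frameNorm_le_supportFn (x : EuclideanSpace ℝ (Fin d))]
    · have hx1 : ‖(x : EuclideanSpace ℝ (Fin d))‖ = 1 := by simp
      have hmem : c + r • (x : EuclideanSpace ℝ (Fin d)) ∈ Ω := hc (by
        rw [Metric.mem_closedBall, dist_eq_norm, add_sub_cancel_left, norm_smul, hx1, mul_one,
          Real.norm_of_nonneg hr0.le])
      have := le_supportFn (z := z') (x := (x : EuclideanSpace ℝ (Fin d))) (hmid z hz _ hmem)
      have e : (1 / 2 : ℝ) • z + (1 / 2 : ℝ) • (c + r • (x : EuclideanSpace ℝ (Fin d))) - z' =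
          (1 / 2 * r) • (x : EuclideanSpace ℝ (Fin d)) := by
        rw [hz']; module
      rw [e, real_inner_smul_left, real_inner_self_eq_norm_sq, hx1] at this
      linarith
  have hmean : ⨍⁻ x : Metric.sphere (0 : EuclideanSpace ℝ (Fin d)) 1,
      ENNReal.ofReal (H x) ^ (-p) ∂(sphereMeasure d) ≤
        ENNReal.ofReal (M₂ * ρ ^ ((d : ℝ) - p)) := by
    have h1 : ∀ x : Metric.sphere (0 : EuclideanSpace ℝ (Fin d)) 1,
        ENNReal.ofReal (H x) ^ (-p) ≤ ENNReal.ofReal ((ρ / 4) ^ ((d : ℝ) - p)) *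
          ENNReal.ofReal (frameNorm b (fun i => 1 / 2 * a i) x) ^ (-(d : ℝ)) := fun x => by
      have hHx : 0 < H x := lt_of_lt_of_le (by positivity) (le_max_right _ _)
      have e : -p = ((d : ℝ) - p) + (-(d : ℝ)) := by ring
      rw [e, ENNReal.rpow_add _ _ (by simpa using hHx) ENNReal.ofReal_ne_top,
        ← ENNReal.ofReal_rpow_of_pos (by positivity)]
      exact mul_le_mul' (ofReal_rpow_le_ofReal_rpow_of_nonpos (le_max_right _ _) (by linarith))
        (ofReal_rpow_le_ofReal_rpow_of_nonpos (le_max_left _ _) (by linarith))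
    refine (lintegral_mono h1).trans ?_
    rw [lintegral_const_mul' _ _ ENNReal.ofReal_ne_top]
    -- At order `-d` the factor `a j ^ (d - p)` becomes 1, leaving only the product of the
    -- half-axes.
    have h2 := laverage_frameNorm_le b hhalf j (p := d) (by linarith) (by linarith) le_rfl
    rw [sub_self, Real.rpow_zero, mul_one, Finset.prod_mul_distrib, Finset.prod_const,
      Finset.card_univ, Fintype.card_fin, mul_inv] at h2
    refine (mul_le_mul_right h2 _).trans ?_
    rw [← ENNReal.ofReal_mul (by positivity)]
    refine ENNReal.ofReal_le_ofReal ?_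
    have h3 := h.inv_prod_le
    have h4 : (ρ / 4) ^ ((d : ℝ) - p) = ρ ^ ((d : ℝ) - p) * (1 / 4) ^ ((d : ℝ) - p) := by
      rw [← Real.mul_rpow hρ.le (by norm_num)]; congr 1; ring
    calc _ ≤ (ρ / 4) ^ ((d : ℝ) - p) *
          (meanConst d d * (((1 / 2) ^ d)⁻¹ * (boxRatio d ^ d / boxConst d))) := by gcongr
      _ = M₂ * ρ ^ ((d : ℝ) - p) := by rw [h4, hM₂]; ring
  have hlo := le_entropyAt_of_laverage_le (Ω := Ω) (z := z') hα0 hp0 (by rw [hp]; linarith)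
    (by positivity)
    ((((continuous_frameNorm b _).max continuous_const)).comp continuous_subtype_val)
    (fun x => lt_of_lt_of_le (by positivity) (le_max_right _ _)) hHle hmean
  obtain ⟨E, hE, h1, h2⟩ := exists_entropy_eq (hmid z hz c hcΩ) hlo hhi
  refine ⟨E, hE, ?_⟩
  have hρp := (Real.rpow_pos_of_pos hρ ((d : ℝ) - p)).ne'
  rw [Real.log_mul hM₂0.ne' hρp, Real.log_rpow hρ] at h1
  rw [Real.log_mul hM₁0.ne' hρp, Real.log_rpow hρ] at h2
  have hip : 0 < 1 / p := by positivity
  have h3 := mul_le_mul_of_nonneg_left (le_abs_self (Real.log M₂)) hip.le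
  have h4 := mul_le_mul_of_nonneg_left (neg_abs_le (Real.log M₁)) hip.le
  have h5 := mul_nonneg hip.le (abs_nonneg (Real.log M₂))
  have h6 := mul_nonneg hip.le (abs_nonneg (Real.log M₁))
  rw [hγ, abs_le]
  constructor <;> linarith

end ConvexEntropy

theorem proposition2p5 (n : ℕ) (hn : 1 ≤ n) :
    (∀ α : ℝ, 1 / ((n : ℝ) + 2) < α →
      ∃ β C : ℝ, 0 < β ∧ 0 < C ∧
        ∀ Ω : ConvexBody (EuclideanSpace ℝ (Fin (n + 1))),
          volume (Ω : Set (EuclideanSpace ℝ (Fin (n + 1)))) =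
            volume (Metric.ball (0 : EuclideanSpace ℝ (Fin (n + 1))) 1) →
          ∃ E : ℝ, ConvexEntropy.entropy α Ω = (E : EReal) ∧
            C⁻¹ * Real.exp (-β * E) ≤
              min (ConvexEntropy.innerRadius Ω) (ConvexEntropy.minWidth Ω) ∧
            max (ConvexEntropy.maxWidth Ω) (ConvexEntropy.outerRadius Ω) ≤
              C * Real.exp ((n : ℝ) * β * E)) ∧
    (∀ α : ℝ, 0 < α → α < 1 / ((n : ℝ) + 2) →
      ∃ C : ℝ, 0 < C ∧
        ∀ Ω : ConvexBody (EuclideanSpace ℝ (Fin (n + 1))),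
          volume (Ω : Set (EuclideanSpace ℝ (Fin (n + 1)))) =
            volume (Metric.ball (0 : EuclideanSpace ℝ (Fin (n + 1))) 1) →
          ∃ E : ℝ, ConvexEntropy.entropy α Ω = (E : EReal) ∧
            |E - (1 - α * ((n : ℝ) + 2)) / (1 - α) *
              Real.log (ConvexEntropy.innerRadius Ω)| ≤ C) := by

  have h1 : 1 / ((n : ℝ) + 2) = 1 / (((n + 1 : ℕ) : ℝ) + 1) := by push_cast; ring_nf
  have h2 : (n : ℝ) + 2 = ((n + 1 : ℕ) : ℝ) + 1 := by push_cast; ring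
  refine ⟨fun α hα => ?_, fun α hα0 hα => ?_⟩
  · rw [h1] at hα
    simpa using ConvexEntropy.entropy_bounds_of_supercritical hα
  · rw [h1] at hα
    rw [h2]
    exact ConvexEntropy.entropy_bounds_of_subcritical hα0 hα
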